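/- Let $I\subseteq\mathbb R$ be an open interval and let $\gamma:I\to\mathbb R^2\setminus\{0\}$ be a $C^\infty$ unit speed curve. For a regular plane curve $c$ write $t=c'/\|c'\|$, $n=Jt$ with $J=\begin{pmatrix}0&-1\\1&0\end{pmatrix}$, and let $\kappa_c=\det(c',c'')/\|c'\|^3$ be its signed curvature; $t,n,\kappa$ without index refer to $\gamma$. Let $\Psi(x)=x/\|x\|^2$ on $\mathbb R^2\setminus\{0\}$, let $\mathrm{Pe}_c(s)=\langle c(s),n_c(s)\rangle n_c(s)$ be the pedal of $c$, and let $$\mathrm{Pr}_\gamma(s)=2\gamma(s)-\frac{\|\gamma(s)\|^2}{\langle n(s),\gamma(s)\rangle}\,n(s)$$ be the primitive of $\gamma$ (the envelope of the lines through $\gamma(s)$ orthogonal to the position vector $\gamma(s)$), defined where $\langle n(s),\gamma(s)\rangle\neq0$. Let $C=\{(t^2,t^3): t\in\mathbb R\}$ be the ordinary cusp. A curve $c$ is said to be locally diffeomorphic to the ordinary cusp at $s_0$ if there is a $C^\infty$ diffeomorphism $\Phi$ from an open neighbourhood of $c(s_0)$ onto an open neighbourhood of $0$ with $\Phi(c(s_0))=0$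 such that, for every sufficiently small $\varepsilon>0$, the set $\Phi(c((s_0-\varepsilon,s_0+\varepsilon)))$ and $C$ coincide in some neighbourhood of $0$. Let $s_0\in I$ with $\langle\gamma(s_0),n(s_0)\rangle\neq0$. Then the following conditions are equivalent: 1. $\mathrm{Pr}_\gamma$ is locally diffeomorphic to the ordinary cusp at $s_0$; 2. the pedal $\mathrm{Pe}_{\Psi\circ\gamma}$ of $\Psi\circ\gamma$ is locally diffeomorphic to the ordinary cusp at $s_0$; 3. $\kappa(s_0)\|\gamma(s_0)\|^2+2\langle\gamma(s_0),n(s_0)\rangle=0$ and $\kappa'(s_0)\neq0$; 4. $s_0$ is not a vertex of $\gamma$ (that is, $\kappa'(s_0)\neq0$), and $\kappa(s_0)\neq0$ and the osculating circle $\|x-x_0\|^2=1/\kappa(s_0)^2$, $x_0=\gamma(s_0)+\frac1{\kappa(s_0)}n(s_0)$, of $\gamma$ at $s_0$ passes through the origin; 5. $\Psi\circ\gamma(s_0)$ is an ordinary inflection of $\Psi\circ\gamma$, that is, $\kappa_{\Psi\circ\gamma}(s_0)=0$ and $\kappa_{\Psi\circ\gamma}'(s_0)\neq0$. -/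

import Mathlib

open scoped ContDiff RealInnerProductSpace Topology

noncomputable section

namespace PlaneCurve

/-- The Euclidean plane. -/
abbrev Plane : Type := EuclideanSpace ℝ (Fin 2)

/-- The rotation by `π / 2`, i.e. the matrix with rows `(0, -1)` and `(1, 0)`. -/
def J (v : Plane) : Plane := !₂[-(v 1), v 0]

/-- The unit tangent of a regular curve in an arbitrary regular parameter; it is `c'` when `c` has
unit speed. -/
def unitTangent (c : ℝ → Plane) (s : ℝ) : Plane := ‖deriv c s‖⁻¹ • deriv c s

/-- The unit normal `n = J t`. -/
def unitNormal (c : ℝ → Plane) (s : ℝ) : Plane := J (unitTangent c s)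

/-- The signed curvature of a regular curve in an arbitrary regular parameter; it is
`x₁' x₂'' - x₁'' x₂'` when `c` has unit speed. -/
def curvature (c : ℝ → Plane) (s : ℝ) : ℝ :=
  (deriv c s 0 * deriv (deriv c) s 1 - deriv (deriv c) s 0 * deriv c s 1) / ‖deriv c s‖ ^ 3

/-- The pedal curve `⟨c, n⟩ n`. -/
def pedal (c : ℝ → Plane) (s : ℝ) : Plane := ⟪c s, unitNormal c s⟫ • unitNormal c s

/-- The primitive `2 c - (‖c‖² / ⟨n, c⟩) n`; see `eq_primitive_iff` for its description as an
envelope. -/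
def primitive (c : ℝ → Plane) (s : ℝ) : Plane :=
  (2 : ℝ) • c s - (‖c s‖ ^ 2 / ⟪unitNormal c s, c s⟫) • unitNormal c s

/-- The inversion `x ↦ x / ‖x‖²` in the unit circle centred at the origin. -/
def Ψ : Plane → Plane := EuclideanGeometry.inversion (0 : Plane) 1

/-- `s` is a vertex of `c`. (For a regular curve this does not depend on the regular parameter.) -/
def IsVertex (c : ℝ → Plane) (s : ℝ) : Prop := deriv (curvature c) s = 0

/-- `s` is an ordinary inflection of `c`. (For a regular curve this does not depend on the regular
parameter.) -/
def IsOrdinaryInflection (c : ℝ → Plane) (s : ℝ) : Prop :=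
  curvature c s = 0 ∧ deriv (curvature c) s ≠ 0

/-- The centre of curvature of `c` at `s`, meaningful where `curvature c s ≠ 0`. -/
def curvatureCenter (c : ℝ → Plane) (s : ℝ) : Plane := c s + (1 / curvature c s) • unitNormal c s

/-- The osculating circle of `c` at `s` exists and passes through the point `p`. -/
def OsculatingCirclePassesThrough (c : ℝ → Plane) (s : ℝ) (p : Plane) : Prop :=
  curvature c s ≠ 0 ∧ ‖p - curvatureCenter c s‖ ^ 2 = 1 / curvature c s ^ 2

/-- The ordinary cusp. -/
def ordinaryCusp : Set Plane := Set.range fun t : ℝ => !₂[t ^ 2, t ^ 3]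

/-- The curve `c` around `c s₀` is locally diffeomorphic to the ordinary cusp: a smooth local
diffeomorphism of the plane takes `c s₀` to the origin and takes the image of every sufficiently
small interval around `s₀` to a set that has the same germ at the origin as the ordinary cusp. -/
def IsLocallyOrdinaryCusp (c : ℝ → Plane) (s₀ : ℝ) : Prop :=
  ∃ Φ : OpenPartialHomeomorph Plane Plane,
    ContDiffOn ℝ ∞ Φ Φ.source ∧ ContDiffOn ℝ ∞ Φ.symm Φ.target ∧
    c s₀ ∈ Φ.source ∧ Φ (c s₀) = 0 ∧
    ∀ᶠ ε in 𝓝[>] (0 : ℝ), ∃ U ∈ 𝓝 (0 : Plane),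
      c '' Set.Ioo (s₀ - ε) (s₀ + ε) ⊆ Φ.source ∧
      Φ '' (c '' Set.Ioo (s₀ - ε) (s₀ + ε)) ∩ U = ordinaryCusp ∩ U

/-- The primitive is the envelope of the lines through `c u` orthogonal to the position vector
`c u`: its point at `s` is the only common zero of `H` and `∂H/∂s`, `H(u, x) = ⟨x - c u, c u⟩`. -/
theorem eq_primitive_iff (c : ℝ → Plane) (s : ℝ) (x : Plane) (hd : DifferentiableAt ℝ c s)
    (hu : ‖deriv c s‖ = 1) (hn : ⟪c s, unitNormal c s⟫ ≠ 0) :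
    x = primitive c s ↔
      ⟪x - c s, c s⟫ = 0 ∧ deriv (fun u => ⟪x - c u, c u⟫) s = 0 := by
  have hder : deriv (fun u => ⟪x - c u, c u⟫) s
      = ⟪x - c s, deriv c s⟫ + ⟪-deriv c s, c s⟫ := by
    have h1 : HasDerivAt (fun u => x - c u) (-deriv c s) s := by
      simpa using hd.hasDerivAt.const_sub x
    exact (h1.inner ℝ hd.hasDerivAt).deriv
  rw [hder]
  have hu2 : (deriv c s 0) ^ 2 + (deriv c s 1) ^ 2 = 1 := by
    have := EuclideanSpace.norm_sq_eq (deriv c s)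
    rw [hu] at this
    simpa [Fin.sum_univ_two] using this.symm
  have hc2 : ‖c s‖ ^ 2 = (c s 0) ^ 2 + (c s 1) ^ 2 := by
    rw [EuclideanSpace.norm_sq_eq]; simp [Fin.sum_univ_two]
  have hN : unitNormal c s = !₂[-(deriv c s 1), deriv c s 0] := by
    simp [unitNormal, unitTangent, J, hu]
  have hx : x = primitive c s ↔ x 0 = primitive c s 0 ∧ x 1 = primitive c s 1 := by
    constructor
    · rintro rfl; exact ⟨rfl, rfl⟩
    · rintro ⟨h0, h1⟩; ext i; fin_cases i
      · exact h0
      · exact h1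
  rw [hx]
  simp only [primitive, hc2]
  rw [hN] at hn ⊢
  simp only [PiLp.inner_apply, Fin.sum_univ_two, PiLp.sub_apply, PiLp.smul_apply, PiLp.neg_apply,
    RCLike.inner_apply, conj_trivial, smul_eq_mul, Matrix.cons_val_zero, Matrix.cons_val_one]
    at hn ⊢
  generalize deriv c s 0 = p at *
  generalize deriv c s 1 = q at *
  generalize c s 0 = a at *
  generalize c s 1 = b at *
  generalize x 0 = y at *
  generalize x 1 = z at *
  have hn' : a * -q + b * p ≠ 0 := by
    intro h; apply hn; linear_combination h
  rw [eq_sub_iff_add_eq, eq_sub_iff_add_eq]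
  constructor
  · rintro ⟨h0, h1⟩
    have e0 : y = 2 * a - (a ^ 2 + b ^ 2) / (a * -q + b * p) * -q := by linear_combination h0
    have e1 : z = 2 * b - (a ^ 2 + b ^ 2) / (a * -q + b * p) * p := by linear_combination h1
    have hk : (a ^ 2 + b ^ 2) / (a * -q + b * p) * (a * -q + b * p) = a ^ 2 + b ^ 2 :=
      div_mul_cancel₀ _ hn'
    generalize (a ^ 2 + b ^ 2) / (a * -q + b * p) = k at *
    subst e0 e1
    exact ⟨by linear_combination -hk, by ring⟩
  · rintro ⟨h0, h1⟩
    have hk : (a ^ 2 + b ^ 2) / (a * -q + b * p) * (a * -q + b * p) = a ^ 2 + b ^ 2 :=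
      div_mul_cancel₀ _ hn'
    generalize (a ^ 2 + b ^ 2) / (a * -q + b * p) = k at *
    constructor <;> apply mul_right_cancel₀ hn'
    · linear_combination -q * h0 + b * h1 - q * hk
    · linear_combination p * h0 - a * h1 + p * hk

end PlaneCurve

end

open PlaneCurve
open scoped ContDiff RealInnerProductSpace

open scoped Topology

namespace PlaneCurve

/-! All five conditions reduce to one scalar δ = κ‖γ‖² + 2⟨γ, n⟩ (`osculationDefect`), namely to
δ(s₀) = 0 and κ'(s₀) ≠ 0. The Frenet equations give δ' = κ'‖γ‖². The curvature of Ψ ∘ γ is -δ; the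
power of the origin with respect to the osculating circle is δ/κ; the primitive has velocity -(δ/⟨γ,
n⟩²) Jγ; and the pedal of Ψ ∘ γ is the image under Ψ of the primitive, so that the first two
conditions agree because Ψ is a diffeomorphism away from 0.

The analytic core is `isLocallyOrdinaryCusp_front_iff`: if P' = l V with V(s₀), V'(s₀) independent,
then P is an ordinary cusp at s₀ exactly when l has a simple zero there.

If l has a simple zero, suitable linear coordinates give x = (s - s₀)²A and y = (s - s₀)³B with A, B
nonzero at s₀. A new parameter τ makes x = τ², and splitting a smooth function into even and odd
parts makes y = τ³g(τ²) + τ⁴h(τ²); the shear (x, y) ↦ (x, (y - x²h(x))/g(x)) then produces (τ², τ³).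
The splitting comes from Fourier inversion, as cos(ξt) and sin(ξt)/t are smooth in t².

Conversely, only image sets are compared, so the curve might a priori pause or turn back on the
cusp. In cusp coordinates, with velocity l(v₁, v₂), the point is (u², u³), and where l ≠ 0 and u ≠ 0
the direction of motion gives u = w := 2v₂/(3v₁), with w'(s₀) ≠ 0. Connectedness extends u = w
across the zeros of l (`cusp_parameter_eq`), and since both branches are covered, x = w² on both
sides of s₀. Differentiating twice, l'(s₀)v₁(s₀) = 2w'(s₀)² ≠ 0 (`simple_zero_of_cusp`). -/

open MeasureTheory

/-! ### Even–odd splitting f(t) = g(t²) + t h(t²) of smooth functions. -/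

/-- A smooth function all of whose derivatives are bounded. -/
def HasBoundedDerivs (C : ℝ → ℝ) : Prop :=
  ContDiff ℝ ∞ C ∧ ∀ k : ℕ, ∃ B : ℝ, ∀ z, |iteratedDeriv k C z| ≤ B

theorem HasBoundedDerivs.deriv {C : ℝ → ℝ} (hC : HasBoundedDerivs C) :
    HasBoundedDerivs (deriv C) := by
  refine ⟨(contDiff_infty_iff_deriv.1 hC.1).2, fun k => ?_⟩
  obtain ⟨B, hB⟩ := hC.2 (k + 1)
  exact ⟨B, fun z => by simpa [iteratedDeriv_succ'] using hB z⟩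

theorem HasBoundedDerivs.const_mul {C : ℝ → ℝ} (hC : HasBoundedDerivs C) (a : ℝ) :
    HasBoundedDerivs (fun z => a * C z) := by
  refine ⟨contDiff_const.mul hC.1, fun k => ?_⟩
  obtain ⟨B, hB⟩ := hC.2 k
  refine ⟨|a| * B, fun z => ?_⟩
  rw [iteratedDeriv_const_mul_field, abs_mul]
  exact mul_le_mul_of_nonneg_left (hB z) (abs_nonneg a)

theorem hasBoundedDerivs_of_hasCompactSupport {C : ℝ → ℝ} (hC : ContDiff ℝ ∞ C)
    (hs : HasCompactSupport C) : HasBoundedDerivs C := by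
  refine ⟨hC, fun k => ?_⟩
  have h1 : Continuous (iteratedDeriv k C) :=
    hC.continuous_iteratedDeriv k (by exact_mod_cast le_top)
  have h2 : HasCompactSupport (iteratedDeriv k C) := by
    induction k with
    | zero => simpa using hs
    | succ k ih =>
      rw [iteratedDeriv_succ]
      exact (ih (hC.continuous_iteratedDeriv k (by exact_mod_cast le_top))).deriv
  obtain ⟨B, hB⟩ := h2.exists_bound_of_continuous h1
  exact ⟨B, hB⟩

theorem hasDerivAt_integral_mul_comp_mul {α : Type*} [MeasurableSpace α] {μ : Measure α}
    {φ q : α → ℝ} {C : ℝ → ℝ} (hC : HasBoundedDerivs C) (hq : AEStronglyMeasurable q μ)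
    (hφ : ∀ k : ℕ, Integrable (fun a => φ a * q a ^ k) μ) (x : ℝ) :
    HasDerivAt (fun x => ∫ a, φ a * C (x * q a) ∂μ)
      (∫ a, (φ a * q a) * deriv C (x * q a) ∂μ) x := by
  obtain ⟨B0, hB0⟩ := hC.2 0
  obtain ⟨B1, hB1⟩ := hC.2 1
  simp only [iteratedDeriv_zero, iteratedDeriv_one] at hB0 hB1
  have hφ0 : Integrable φ μ := by simpa using hφ 0
  have hφ1 : Integrable (fun a => φ a * q a) μ := by simpa using hφ 1
  have hm (D : ℝ → ℝ) (hD : Continuous D) (x : ℝ) :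
      AEStronglyMeasurable (fun a => D (x * q a)) μ :=
    hD.comp_aestronglyMeasurable (hq.const_mul x)
  refine (hasDerivAt_integral_of_dominated_loc_of_deriv_le (s := Set.univ)
    (F' := fun y a => (φ a * q a) * _root_.deriv C (y * q a))
    (bound := fun a => |φ a * q a| * B1) Filter.univ_mem
    (.of_forall fun y => hφ0.aestronglyMeasurable.mul (hm C hC.1.continuous y))
    (hφ0.mul_bdd (c := B0) (hm C hC.1.continuous x) (.of_forall fun a => hB0 _))
    (hφ1.aestronglyMeasurable.mul (hm _ hC.deriv.1.continuous x))
    (.of_forall fun a y _ => ?_) (hφ1.abs.mul_const _) (.of_forall fun a y _ => ?_)).2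
  · rw [Real.norm_eq_abs, abs_mul]
    exact mul_le_mul_of_nonneg_left (hB1 _) (abs_nonneg _)
  · have h1 : HasDerivAt C (deriv C (y * q a)) (y * q a) :=
      (hC.1.differentiable (by simp) _).hasDerivAt
    have h2 : HasDerivAt (fun y => y * q a) (q a) y := by
      simpa using (hasDerivAt_id y).mul_const (q a)
    exact ((h1.comp y h2).const_mul (φ a)).congr_deriv (by ring)

/-- Differentiating under the integral keeps the shape, with φ replaced by φq and C by its
derivative. Hence the induction generalizes over both, and all moments of φ are assumed. -/
theorem contDiff_integral_mul_comp_mul {α : Type*} [MeasurableSpace α] {μ : Measure α}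
    {φ q : α → ℝ} {C : ℝ → ℝ} (hC : HasBoundedDerivs C) (hq : AEStronglyMeasurable q μ)
    (hφ : ∀ k : ℕ, Integrable (fun a => φ a * q a ^ k) μ) :
    ContDiff ℝ ∞ (fun x => ∫ a, φ a * C (x * q a) ∂μ) := by
  rw [contDiff_infty]
  intro n
  induction n generalizing φ C with
  | zero =>
    rw [Nat.cast_zero, contDiff_zero]
    exact continuous_iff_continuousAt.2 fun x =>
      (hasDerivAt_integral_mul_comp_mul hC hq hφ x).continuousAt
  | succ n ih =>
    rw [Nat.cast_succ, contDiff_succ_iff_deriv]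
    refine ⟨fun x => (hasDerivAt_integral_mul_comp_mul hC hq hφ x).differentiableAt,
      by simp, ?_⟩
    rw [show _root_.deriv (fun x => ∫ a, φ a * C (x * q a) ∂μ) = _ from
      funext fun x => (hasDerivAt_integral_mul_comp_mul hC hq hφ x).deriv]
    refine ih hC.deriv fun k => ?_
    convert hφ (k + 1) using 2
    ring

/-- The function `cos ∘ √` on `[0, ∞)` extends to a smooth function on the line. -/
theorem exists_contDiff_cos_sq : ∃ F : ℝ → ℝ, ContDiff ℝ ∞ F ∧ ∀ z, F (z ^ 2) = Real.cos z := by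
  let c : ℕ → ℝ := fun n => (-1) ^ n / (2 * n).factorial
  -- The cosine series with z² replaced by z; its radius is infinite by the ratio test.
  let p := FormalMultilinearSeries.ofScalars ℝ c
  have hp : p.radius = ⊤ := by
    apply FormalMultilinearSeries.ofScalars_radius_eq_top_of_tendsto
    · exact .of_forall fun n => by simp [c, Nat.factorial_ne_zero]
    · refine squeeze_zero (fun n => by positivity) (g := fun n : ℕ => 1 / ((n : ℝ) + 1))
        (fun n => ?_) tendsto_one_div_add_atTop_nhds_zero_nat
      have : (2 * (n + 1)).factorial = (2 * n + 2) * ((2 * n + 1) * (2 * n).factorial) := by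
        rw [show 2 * (n + 1) = 2 * n + 1 + 1 by ring, Nat.factorial_succ, Nat.factorial_succ]
      simp only [c, Nat.succ_eq_add_one, this, norm_div, norm_pow, norm_neg, norm_one, one_pow,
        RCLike.norm_natCast]
      have h0 : ((2 * n).factorial : ℝ) ≠ 0 := by positivity
      push_cast
      rw [show (1 : ℝ) / ((2 * n + 2) * ((2 * n + 1) * (2 * n).factorial)) /
        (1 / (2 * n).factorial) = 1 / ((2 * n + 2) * (2 * n + 1)) by field_simp]
      have hn : (0 : ℝ) ≤ n := by positivity
      exact one_div_le_one_div_of_le (by positivity) (by nlinarith)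
  have hf : HasFPowerSeriesOnBall p.sum p 0 p.radius := p.hasFPowerSeriesOnBall (by simp [hp])
  refine ⟨p.sum, ?_, fun z => ?_⟩
  · rw [contDiff_iff_contDiffAt]
    intro x
    exact (hf.analyticAt_of_mem (by simp [hp])).contDiffAt
  · rw [← (Real.hasSum_cos z).tsum_eq]
    change FormalMultilinearSeries.ofScalarsSum c (z ^ 2) = _
    rw [FormalMultilinearSeries.ofScalars_sum_eq]
    refine tsum_congr fun n => ?_
    simp only [c, smul_eq_mul]
    rw [← pow_mul]; ring

/-- For z ≥ 1 the argument 1/√z lies in [0, 1], so this form bounds every derivative of cos √z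
there. -/
theorem iteratedDeriv_cos_sqrt (k : ℕ) : ∃ p q : Polynomial ℝ, ∀ z : ℝ, 0 < z →
    iteratedDeriv k (fun z => Real.cos (√z)) z =
      p.eval (1 / √z) * Real.cos (√z) + q.eval (1 / √z) * Real.sin (√z) := by
  open Polynomial in
  induction k with
  | zero => exact ⟨1, 0, fun z _ => by simp⟩
  | succ k ih =>
    obtain ⟨p, q, h⟩ := ih
    refine ⟨C (-1 / 2) * X ^ 3 * derivative p + C (1 / 2) * X * q,
      C (-1 / 2) * X ^ 3 * derivative q - C (1 / 2) * X * p, fun z hz => ?_⟩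
    have hs : √z ≠ 0 := (Real.sqrt_pos.2 hz).ne'
    have h1 : HasDerivAt (fun z : ℝ => √z) (1 / (2 * √z)) z := Real.hasDerivAt_sqrt hz.ne'
    have h2 : HasDerivAt (fun z : ℝ => 1 / √z) (-(1 / 2) * (1 / √z) ^ 3) z := by
      simp only [one_div]
      exact (h1.inv hs).congr_deriv (by field_simp)
    have h3 (r : ℝ[X]) := (r.hasDerivAt (1 / √z)).comp z h2
    have h4 := ((h3 p).mul h1.cos).add ((h3 q).mul h1.sin)
    rw [iteratedDeriv_succ]
    have h5 : iteratedDeriv k (fun z => Real.cos (√z)) =ᶠ[𝓝 z] fun z =>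
        p.eval (1 / √z) * Real.cos (√z) + q.eval (1 / √z) * Real.sin (√z) := by
      filter_upwards [lt_mem_nhds hz] with y hy using h y hy
    rw [h5.deriv_eq]
    refine h4.deriv.trans ?_
    simp
    field_simp
    ring

/-- The function `cos ∘ √` on `[0, ∞)` extends to a smooth function with bounded derivatives. -/
theorem exists_hasBoundedDerivs_cos_sq :
    ∃ C : ℝ → ℝ, HasBoundedDerivs C ∧ ∀ z, C (z ^ 2) = Real.cos z := by
  obtain ⟨F, hF, hFc⟩ := exists_contDiff_cos_sq
  -- On the negative axis F is cosh √|z|, which is unbounded. The cutoff is 1 for z ≥ 0 and 0 for z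
  -- ≤ -1, leaving a compact range [-1, 1] and the tail z > 1 to be bounded.
  have hsm : ContDiff ℝ ∞ fun z => F z * Real.smoothTransition (z + 1) :=
    hF.mul (Real.smoothTransition.contDiff.comp (contDiff_id.add contDiff_const))
  have hpos : ∀ z, 0 ≤ z → F z * Real.smoothTransition (z + 1) = Real.cos (√z) := by
    intro z hz
    rw [Real.smoothTransition.one_of_one_le (by linarith), mul_one, ← hFc, Real.sq_sqrt hz]
  refine ⟨_, ⟨hsm, fun k => ?_⟩, fun z => ?_⟩
  · obtain ⟨B, hB⟩ := (isCompact_Icc (a := (-1 : ℝ)) (b := 1)).exists_bound_of_continuousOn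
      (hsm.continuous_iteratedDeriv k (by exact_mod_cast le_top)).continuousOn
    obtain ⟨p, q, hpq⟩ := iteratedDeriv_cos_sqrt k
    obtain ⟨P, hP⟩ := (isCompact_Icc (a := (0 : ℝ)) (b := 1)).exists_bound_of_continuousOn
      p.continuous.continuousOn
    obtain ⟨Q, hQ⟩ := (isCompact_Icc (a := (0 : ℝ)) (b := 1)).exists_bound_of_continuousOn
      q.continuous.continuousOn
    refine ⟨max B (P + Q), fun z => ?_⟩
    rcases lt_or_ge z (-1) with h | h
    · have : (fun z => F z * Real.smoothTransition (z + 1)) =ᶠ[𝓝 z] fun _ => (0 : ℝ) := by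
        filter_upwards [gt_mem_nhds h] with y hy
        rw [Real.smoothTransition.zero_of_nonpos (by linarith), mul_zero]
      rw [this.iteratedDeriv_eq]
      have : (0 : ℝ) ≤ B := (norm_nonneg _).trans (hB 0 (by norm_num))
      rw [iteratedDeriv_const]
      simp [this]
    rcases le_or_gt z 1 with h' | h'
    · exact (hB z ⟨h, h'⟩).trans (le_max_left _ _)
    · have hz : 0 < z := by linarith
      have : (fun z => F z * Real.smoothTransition (z + 1)) =ᶠ[𝓝 z] fun z => Real.cos (√z) := by
        filter_upwards [lt_mem_nhds hz] with y hy using hpos y hy.le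
      rw [this.iteratedDeriv_eq, hpq z hz]
      have hI : 1 / √z ∈ Set.Icc (0 : ℝ) 1 :=
        ⟨by positivity, by
          rw [div_le_one (Real.sqrt_pos.2 hz)]; exact Real.one_le_sqrt.2 h'.le⟩
      refine le_trans ?_ (le_max_right _ _)
      refine (abs_add_le _ _).trans ?_
      rw [abs_mul, abs_mul]
      have e1 := hP _ hI
      have e2 := hQ _ hI
      rw [Real.norm_eq_abs] at e1 e2
      exact add_le_add
        ((mul_le_of_le_one_right (abs_nonneg _) (Real.abs_cos_le_one _)).trans e1)
        ((mul_le_of_le_one_right (abs_nonneg _) (Real.abs_sin_le_one _)).trans e2)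
  · rw [hpos _ (sq_nonneg z), Real.sqrt_sq_eq_abs, Real.cos_abs]

-- Fourier inversion, with a and b the real and imaginary parts of the transform of f. The transform
-- is a Schwartz function, so all moments are integrable.
open scoped FourierTransform in
theorem exists_eq_integral_cos_sub_sin {f : ℝ → ℝ} (hf : ContDiff ℝ ∞ f)
    (hs : HasCompactSupport f) : ∃ a b : ℝ → ℝ,
      (∀ k : ℕ, Integrable (fun ξ => a ξ * ξ ^ k)) ∧ (∀ k : ℕ, Integrable (fun ξ => b ξ * ξ ^ k)) ∧
      ∀ t, f t = ∫ ξ, (a ξ * Real.cos (2 * Real.pi * ξ * t) -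
        b ξ * Real.sin (2 * Real.pi * ξ * t)) := by
  have hs' : HasCompactSupport (fun t => (f t : ℂ)) := hs.comp_left Complex.ofReal_zero
  have hf' : ContDiff ℝ ∞ (fun t => (f t : ℂ)) := Complex.ofRealCLM.contDiff.comp hf
  let F : SchwartzMap ℝ ℂ := hs'.toSchwartzMap hf'
  let φ : SchwartzMap ℝ ℂ := 𝓕 F
  have hint (k : ℕ) : Integrable (fun ξ : ℝ => φ ξ * (ξ : ℂ) ^ k) := by
    refine (φ.integrable_pow_mul volume k).mono
      (φ.continuous.mul (by fun_prop)).aestronglyMeasurable (.of_forall fun ξ => ?_)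
    simp [mul_comm]
  refine ⟨fun ξ => (φ ξ).re, fun ξ => (φ ξ).im, fun k => ?_, fun k => ?_, fun t => ?_⟩
  · refine (hint k).re.congr (.of_forall fun ξ => ?_)
    simp [← Complex.ofReal_pow]
  · refine (hint k).im.congr (.of_forall fun ξ => ?_)
    simp [← Complex.ofReal_pow]
  · have h1 : 𝓕⁻ (𝓕 F) = F := FourierTransform.fourierInv_fourier_eq F
    have h2 : (F t : ℂ) = ∫ ξ, Complex.exp (↑(2 * Real.pi * ⟪ξ, t⟫) * Complex.I) • φ ξ := by
      conv_lhs => rw [← h1]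
      rw [SchwartzMap.fourierInv_coe, Real.fourierInv_eq']
    have h3 : f t = (F t : ℂ).re := rfl
    rw [h3, h2]
    have h4 : Integrable fun ξ : ℝ => Complex.exp (↑(2 * Real.pi * ⟪ξ, t⟫) * Complex.I) • φ ξ := by
      have := hint 0
      simp only [pow_zero, mul_one] at this
      refine this.mono ?_ (.of_forall fun ξ => ?_)
      · have hc : Continuous fun ξ : ℝ =>
            Complex.exp (↑(2 * Real.pi * ⟪ξ, t⟫) * Complex.I) := by fun_prop
        exact (hc.smul φ.continuous).aestronglyMeasurable
      · rw [norm_smul, Complex.norm_exp_ofReal_mul_I, one_mul]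
    rw [← RCLike.re_eq_complex_re, ← integral_re h4]
    refine integral_congr_ae (.of_forall fun ξ => ?_)
    have : 2 * Real.pi * ⟪ξ, t⟫ = 2 * Real.pi * ξ * t := by simp; ring
    simp only [this]
    rw [Complex.exp_mul_I, ← Complex.ofReal_cos, ← Complex.ofReal_sin]
    simp only [smul_eq_mul, RCLike.re_eq_complex_re, Complex.mul_re, Complex.add_re,
      Complex.add_im, Complex.mul_im, Complex.ofReal_re, Complex.ofReal_im, Complex.I_re,
      Complex.I_im]
    ring

/-- Every smooth compactly supported function of `t` has the form `g (t²) + t h (t²)` with smooth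
`g` and `h`. -/
theorem exists_eq_comp_sq_add_mul_comp_sq {f : ℝ → ℝ} (hf : ContDiff ℝ ∞ f)
    (hs : HasCompactSupport f) : ∃ g h : ℝ → ℝ, ContDiff ℝ ∞ g ∧ ContDiff ℝ ∞ h ∧
      ∀ t, f t = g (t ^ 2) + t * h (t ^ 2) := by
  obtain ⟨C, hC, hCc⟩ := exists_hasBoundedDerivs_cos_sq
  -- Obtained by differentiating C(z²) = cos z; it exhibits sin z / z as a smooth function of z².
  have hS : ∀ z, z * (-2 * deriv C (z ^ 2)) = Real.sin z := by
    intro z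
    have h1 : HasDerivAt C (deriv C (z ^ 2)) (z ^ 2) :=
      (hC.1.differentiable (by simp) _).hasDerivAt
    have h3 : HasDerivAt (fun z : ℝ => z ^ 2) (2 * z) z := by simpa using hasDerivAt_pow 2 z
    have h2 : HasDerivAt (fun z => C (z ^ 2)) (deriv C (z ^ 2) * (2 * z)) z :=
      HasDerivAt.comp (h₂ := C) (h := fun z => z ^ 2) z h1 h3
    rw [funext hCc] at h2
    have := h2.unique (Real.hasDerivAt_cos z)
    linear_combination -this
  obtain ⟨a, b, ha, hb, hab⟩ := exists_eq_integral_cos_sub_sin hf hs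
  have hS' : HasBoundedDerivs fun z => -2 * deriv C z := hC.deriv.const_mul _
  let q : ℝ → ℝ := fun ξ => (2 * Real.pi * ξ) ^ 2
  have hq : AEStronglyMeasurable q := (by fun_prop : Continuous q).aestronglyMeasurable
  have ha' : ∀ k : ℕ, Integrable (fun ξ => a ξ * q ξ ^ k) := fun k => by
    refine ((ha (2 * k)).const_mul ((2 * Real.pi) ^ (2 * k))).congr (.of_forall fun ξ => ?_)
    simp only [q, ← pow_mul, mul_pow]; ring
  have hb' : ∀ k : ℕ, Integrable (fun ξ => (-(b ξ) * (2 * Real.pi * ξ)) * q ξ ^ k) := fun k => by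
    refine ((hb (2 * k + 1)).const_mul (-(2 * Real.pi) ^ (2 * k + 1))).congr
      (.of_forall fun ξ => ?_)
    simp only [q, ← pow_mul, mul_pow]; ring
  -- The cosine integral is g(t²). In the sine integral the factor 2πξt splits into t, which is
  -- pulled out, and 2πξ, which joins the weight of h.
  refine ⟨_, _, contDiff_integral_mul_comp_mul hC hq ha', contDiff_integral_mul_comp_mul hS' hq hb',
    fun t => ?_⟩
  have hbd {D : ℝ → ℝ} (hD : HasBoundedDerivs D) {φ : ℝ → ℝ}
      (hφ : ∀ k : ℕ, Integrable (fun ξ => φ ξ * q ξ ^ k)) (x : ℝ) :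
      Integrable fun ξ => φ ξ * D (x * q ξ) := by
    obtain ⟨B, hB⟩ := hD.2 0
    have h0 : Integrable φ := by simpa using hφ 0
    exact h0.mul_bdd (c := B) (hD.1.continuous.comp_aestronglyMeasurable (hq.const_mul x))
      (.of_forall fun ξ => by simpa using hB _)
  rw [hab, ← integral_const_mul, ← integral_add (hbd hC ha' _) ((hbd hS' hb' _).const_mul _)]
  refine integral_congr_ae (.of_forall fun ξ => ?_)
  have e : t ^ 2 * q ξ = (2 * Real.pi * ξ * t) ^ 2 := by simp only [q]; ring
  simp only [e, hCc, ← hS]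
  ring

/-! ### Localization and Hadamard's lemma. -/

/-- A smooth function near a point extends from a neighbourhood of the point to a smooth compactly
supported function on the line. -/
theorem exists_contDiff_hasCompactSupport_eventuallyEq {f : ℝ → ℝ} {U : Set ℝ} {s₀ : ℝ}
    (hU : IsOpen U) (hs₀ : s₀ ∈ U) (hf : ContDiffOn ℝ ∞ f U) :
    ∃ g : ℝ → ℝ, ContDiff ℝ ∞ g ∧ HasCompactSupport g ∧ g =ᶠ[𝓝 s₀] f := by
  obtain ⟨r, hr, hrU⟩ := Metric.nhds_basis_closedBall.mem_iff.1 (hU.mem_nhds hs₀)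
  let χ : ContDiffBump s₀ := ⟨r / 2, r, by positivity, by linarith⟩
  refine ⟨fun s => χ s * f s, ?_, χ.hasCompactSupport.mul_right, ?_⟩
  · rw [contDiff_iff_contDiffAt]
    intro s
    by_cases hs : s ∈ U
    · exact χ.contDiff.contDiffAt.mul (hf.contDiffAt (hU.mem_nhds hs))
    · have h1 : s ∉ tsupport χ := by
        rw [χ.tsupport_eq]
        exact fun h => hs (hrU h)
      have h2 : (fun s => χ s * f s) =ᶠ[𝓝 s] fun _ => 0 := by
        filter_upwards [(isClosed_tsupport χ).isOpen_compl.mem_nhds h1] with y hy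
        rw [image_eq_zero_of_notMem_tsupport hy, zero_mul]
      exact contDiffAt_const.congr_of_eventuallyEq h2
  · filter_upwards [χ.eventuallyEq_one] with s hs
    simp [hs]

/-- Hadamard's lemma: a function whose derivative is divisible by `(s - s₀) ^ k` and which
vanishes at `s₀` is divisible by `(s - s₀) ^ (k + 1)`. -/
theorem exists_eq_pow_mul_of_hasDerivAt {f m : ℝ → ℝ} {s₀ : ℝ} {k : ℕ} {U : Set ℝ}
    (hU : IsOpen U) (hs₀ : s₀ ∈ U) (hm : ContDiffOn ℝ ∞ m U) (hf₀ : f s₀ = 0)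
    (hf : ∀ s ∈ U, HasDerivAt f ((s - s₀) ^ k * m s) s) :
    ∃ g : ℝ → ℝ, ContDiff ℝ ∞ g ∧ g s₀ = m s₀ / (k + 1) ∧
      ∀ᶠ s in 𝓝 s₀, f s = (s - s₀) ^ (k + 1) * g s := by
  -- The quotient is ∫₀¹ uᵏ m(s₀ + u(s - s₀)) du. Replacing m by a compactly supported M makes it a
  -- globally defined smooth parametric integral.
  obtain ⟨M, hM, hMs, hMm⟩ := exists_contDiff_hasCompactSupport_eventuallyEq hU hs₀ hm
  have hM₀ : M s₀ = m s₀ := hMm.eq_of_nhds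
  have hM' : HasBoundedDerivs fun s => M (s + s₀) :=
    hasBoundedDerivs_of_hasCompactSupport (hM.comp (contDiff_id.add contDiff_const))
      (hMs.comp_homeomorph (Homeomorph.addRight s₀))
  let μ : Measure ℝ := volume.restrict (Set.Ioc 0 1)
  have hint (D : ℝ → ℝ) (hD : Continuous D) : Integrable D μ :=
    (hD.integrableOn_Icc).mono_set Set.Ioc_subset_Icc_self
  have hG := contDiff_integral_mul_comp_mul (μ := μ) (φ := fun u => u ^ k) (q := id) hM'
    aestronglyMeasurable_id (fun j => hint _ (by fun_prop))
  refine ⟨fun s => ∫ u, u ^ k * M ((s - s₀) * u + s₀) ∂μ,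
    hG.comp (contDiff_id.sub contDiff_const), ?_, ?_⟩
  · simp only [sub_self, zero_mul, zero_add, integral_mul_const, hM₀]
    rw [show ∫ u, u ^ k ∂μ = ∫ u in (0 : ℝ)..1, u ^ k from
      (intervalIntegral.integral_of_le zero_le_one).symm, integral_pow]
    simp
    ring
  · obtain ⟨r, hr, hrU⟩ := Metric.nhds_basis_ball.mem_iff.1
      (Filter.inter_mem (hU.mem_nhds hs₀) hMm)
    filter_upwards [Metric.ball_mem_nhds s₀ hr] with s hs
    have hseg : ∀ u ∈ Set.Icc (0 : ℝ) 1, (s - s₀) * u + s₀ ∈ Metric.ball s₀ r := by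
      intro u hu
      rw [Metric.mem_ball, Real.dist_eq] at hs ⊢
      rw [add_sub_cancel_right, abs_mul, abs_of_nonneg hu.1]
      exact (mul_le_of_le_one_right (abs_nonneg _) hu.2).trans_lt hs
    have hd : ∀ u ∈ Set.uIcc (0 : ℝ) 1, HasDerivAt (fun u => f ((s - s₀) * u + s₀))
        ((s - s₀) ^ (k + 1) * (u ^ k * M ((s - s₀) * u + s₀))) u := by
      intro u hu
      rw [Set.uIcc_of_le zero_le_one] at hu
      have h1 := hrU (hseg u hu)
      have h2 : HasDerivAt (fun u => (s - s₀) * u + s₀) (s - s₀) u := by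
        simpa using ((hasDerivAt_id u).const_mul (s - s₀)).add_const s₀
      refine ((hf _ h1.1).comp u h2).congr_deriv ?_
      have h3 : M ((s - s₀) * u + s₀) = m ((s - s₀) * u + s₀) := h1.2
      rw [h3, add_sub_cancel_right, mul_pow]
      ring
    have h4 := intervalIntegral.integral_eq_sub_of_hasDerivAt hd
      (Continuous.intervalIntegrable (by fun_prop) _ _)
    simp only [mul_one, sub_add_cancel, mul_zero, zero_add, hf₀, sub_zero] at h4
    rw [← h4, intervalIntegral.integral_const_mul, intervalIntegral.integral_of_le zero_le_one]

/-! ### A simple zero of the speed gives an ordinary cusp. -/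

theorem contDiffOn_vec {E : Type*} [NormedAddCommGroup E] [NormedSpace ℝ E] {f g : E → ℝ}
    {S : Set E} {n : WithTop ℕ∞} (hf : ContDiffOn ℝ n f S) (hg : ContDiffOn ℝ n g S) :
    ContDiffOn ℝ n (fun p => (!₂[f p, g p] : Plane)) S := by
  rw [contDiffOn_euclidean]
  intro i
  fin_cases i
  · exact hf
  · exact hg

theorem contDiff_coord (i : Fin 2) : ContDiff ℝ ∞ fun p : Plane => p i :=
  (EuclideanSpace.proj i : Plane →L[ℝ] ℝ).contDiff

theorem eventually_forall_Ioo {p : ℝ → Prop} {s₀ : ℝ} (h : ∀ᶠ s in 𝓝 s₀, p s) :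
    ∀ᶠ ε in 𝓝[>] (0 : ℝ), ∀ s ∈ Set.Ioo (s₀ - ε) (s₀ + ε), p s := by
  obtain ⟨r, hr, h⟩ := Metric.eventually_nhds_iff_ball.1 h
  filter_upwards [Ioo_mem_nhdsGT hr] with ε hε s hs
  refine h s ?_
  rw [Real.ball_eq_Ioo]
  exact ⟨by linarith [hs.1, hε.2], by linarith [hs.2, hε.2]⟩

/-- Being locally an ordinary cusp is invariant under local diffeomorphisms of the plane. -/
theorem IsLocallyOrdinaryCusp.of_comp {c c' : ℝ → Plane} {s₀ : ℝ}
    (h : IsLocallyOrdinaryCusp c' s₀) (E : OpenPartialHomeomorph Plane Plane)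
    (hE : ContDiffOn ℝ ∞ E E.source) (hE' : ContDiffOn ℝ ∞ E.symm E.target)
    (hc : ContinuousAt c s₀) (hs : c s₀ ∈ E.source) (hcc' : c' =ᶠ[𝓝 s₀] fun s => E (c s)) :
    IsLocallyOrdinaryCusp c s₀ := by
  obtain ⟨Φ, h1, h2, h3, h4, h5⟩ := h
  rw [hcc'.eq_of_nhds] at h3 h4
  refine ⟨E.trans Φ, ?_, ?_, ?_, h4, ?_⟩
  · rw [E.coe_trans, E.trans_source]
    exact h1.comp (hE.mono Set.inter_subset_left) fun p hp => hp.2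
  · rw [E.coe_trans_symm, E.trans_target]
    exact hE'.comp (h2.mono Set.inter_subset_left) fun p hp => hp.2
  · rw [E.trans_source]
    exact ⟨hs, h3⟩
  · have hsrc : ∀ᶠ s in 𝓝 s₀, c s ∈ E.source := hc.eventually (E.open_source.mem_nhds hs)
    filter_upwards [h5, eventually_forall_Ioo (hcc'.and hsrc)] with ε ⟨U, hU, h6, h7⟩ h8
    refine ⟨U, hU, ?_, ?_⟩
    · rintro _ ⟨s, hs, rfl⟩
      rw [E.trans_source]
      refine ⟨(h8 s hs).2, ?_⟩
      have := h6 ⟨s, hs, rfl⟩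
      rwa [(h8 s hs).1] at this
    · rw [← h7]
      congr 1
      rw [Set.image_image, Set.image_image]
      refine Set.image_congr fun s hs => ?_
      rw [(h8 s hs).1]
      rfl

/-- Take τ = (s - s₀)√A, a local coordinate because τ'(s₀) = √(A s₀) ≠ 0. Then x = τ² and y = τ³b(τ)
with b = B/√A³ read in the coordinate τ; splitting b into even and odd parts gives g and h, and g(0)
= b(0) ≠ 0. -/
theorem exists_normal_parameter {x y A B : ℝ → ℝ} {s₀ : ℝ} (hA : ContDiff ℝ ∞ A)
    (hB : ContDiff ℝ ∞ B) (hA₀ : 0 < A s₀) (hB₀ : B s₀ ≠ 0)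
    (hx : ∀ᶠ s in 𝓝 s₀, x s = (s - s₀) ^ 2 * A s)
    (hy : ∀ᶠ s in 𝓝 s₀, y s = (s - s₀) ^ 3 * B s) :
    ∃ τ g h : ℝ → ℝ, ContDiff ℝ ∞ g ∧ ContDiff ℝ ∞ h ∧ g 0 ≠ 0 ∧ τ s₀ = 0 ∧
      Filter.map τ (𝓝 s₀) = 𝓝 0 ∧
      ∀ᶠ s in 𝓝 s₀, x s = τ s ^ 2 ∧ y s = τ s ^ 3 * g (τ s ^ 2) + (τ s ^ 2) ^ 2 * h (τ s ^ 2) := by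
  let τ : ℝ → ℝ := fun s => (s - s₀) * √(A s)
  have hτ₀ : τ s₀ = 0 := by simp [τ]
  let W : Set ℝ := {s | 0 < A s}
  have hW : IsOpen W := isOpen_lt continuous_const hA.continuous
  have hsqrt : ContDiffOn ℝ ∞ (fun s => √(A s)) W :=
    hA.contDiffOn.sqrt fun s hs => (show 0 < A s from hs).ne'
  have hτ : ContDiffOn ℝ ∞ τ W := (contDiffOn_id.sub contDiffOn_const).mul hsqrt
  have hd : HasDerivAt τ (√(A s₀)) s₀ := by
    have h1 := (hsqrt.contDiffAt (hW.mem_nhds hA₀)).differentiableAt (by simp)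
    exact (((hasDerivAt_id s₀).sub_const s₀).mul h1.hasDerivAt).congr_deriv (by simp)
  have hne : √(A s₀) ≠ 0 := (Real.sqrt_pos.2 hA₀).ne'
  have hcd : ContDiffAt ℝ ∞ τ s₀ := hτ.contDiffAt (hW.mem_nhds hA₀)
  have hstrict : HasStrictDerivAt τ (√(A s₀)) s₀ := hcd.hasStrictDerivAt' hd (by simp)
  let e : OpenPartialHomeomorph ℝ ℝ :=
    hcd.toOpenPartialHomeomorph τ (hd.hasFDerivAt_equiv hne) (by simp)
  have he : ⇑e = τ := rfl
  have hes : s₀ ∈ e.source := hcd.mem_toOpenPartialHomeomorph_source _ (by simp)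
  have hsymm₀ : e.symm 0 = s₀ := by rw [← hτ₀, ← he]; exact e.left_inv hes
  -- Smoothness of the inverse is needed on an open set, not only at 0, so the parameters are
  -- restricted to those where τ' does not vanish.
  let W' : Set ℝ := W ∩ deriv τ ⁻¹' {0}ᶜ
  have hW' : IsOpen W' :=
    (hτ.continuousOn_deriv_of_isOpen hW (by simp)).isOpen_inter_preimage hW
      isOpen_compl_singleton
  let T : Set ℝ := e.target ∩ e.symm ⁻¹' W'
  have hT : IsOpen T := e.symm.isOpen_inter_preimage hW'
  have h0T : (0 : ℝ) ∈ T := by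
    refine ⟨?_, ?_⟩
    · rw [← hτ₀, ← he]; exact e.map_source hes
    · rw [Set.mem_preimage, hsymm₀]
      refine ⟨hA₀, ?_⟩
      rw [Set.mem_preimage, hd.deriv]
      exact hne
  have hsymm : ContDiffOn ℝ ∞ e.symm T := by
    intro t ht
    have h1 : ContDiffAt ℝ ∞ τ (e.symm t) := hτ.contDiffAt (hW.mem_nhds ht.2.1)
    exact (e.contDiffAt_symm_deriv ht.2.2 ht.1
      (h1.differentiableAt (by simp)).hasDerivAt h1).contDiffWithinAt
  let b : ℝ → ℝ := fun t => B (e.symm t) / √(A (e.symm t)) ^ 3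
  have hb : ContDiffOn ℝ ∞ b T := by
    refine (hB.comp_contDiffOn hsymm).div ((hsqrt.comp hsymm fun t ht => ht.2.1).pow 3)
      fun t ht => ?_
    exact pow_ne_zero 3 (Real.sqrt_pos.2 ht.2.1).ne'
  obtain ⟨f, hf, hfs, hfb⟩ := exists_contDiff_hasCompactSupport_eventuallyEq hT h0T hb
  obtain ⟨g, h, hg, hh, hgh⟩ := exists_eq_comp_sq_add_mul_comp_sq hf hfs
  refine ⟨τ, g, h, hg, hh, ?_, hτ₀, ?_, ?_⟩
  · have h1 := hgh 0
    rw [hfb.eq_of_nhds] at h1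
    have h2 : g 0 = b 0 := by simpa using h1.symm
    rw [h2]
    simp only [b, hsymm₀]
    exact div_ne_zero hB₀ (pow_ne_zero 3 hne)
  · rw [hstrict.map_nhds_eq hne, hτ₀]
  · have h1 : ∀ᶠ s in 𝓝 s₀, f (τ s) = b (τ s) := by
      have h2 : Filter.Tendsto τ (𝓝 s₀) (𝓝 0) := by
        simpa [hτ₀] using hd.continuousAt.tendsto
      exact h2.eventually hfb
    filter_upwards [hx, hy, h1, hW.mem_nhds hA₀, e.open_source.mem_nhds hes] with s h2 h3 h4 h5 h6
    have h7 : e.symm (τ s) = s := e.left_inv h6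
    have h8 : √(A s) ^ 2 = A s := Real.sq_sqrt (le_of_lt h5)
    have h9 : √(A s) ≠ 0 := (Real.sqrt_pos.2 h5).ne'
    refine ⟨?_, ?_⟩
    · rw [h2, ← h8]; simp only [τ]; ring
    · have h10 : g (τ s ^ 2) + τ s * h (τ s ^ 2) = B s / √(A s) ^ 3 := by
        rw [← hgh, h4]; simp only [b, h7]
      have h11 : B s = √(A s) ^ 3 * (g (τ s ^ 2) + τ s * h (τ s ^ 2)) := by
        rw [h10]; field_simp
      rw [h3, h11]
      simp only [τ]
      ring

/-- The shear `(x, y) ↦ (x, (y - x² h x) / g x)`, defined where `g x ≠ 0`. -/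
noncomputable def shear (g h : ℝ → ℝ) (hg : Continuous g) (hh : Continuous h) :
    OpenPartialHomeomorph Plane Plane where
  toFun p := !₂[p 0, (p 1 - p 0 ^ 2 * h (p 0)) / g (p 0)]
  invFun p := !₂[p 0, p 1 * g (p 0) + p 0 ^ 2 * h (p 0)]
  source := {p | g (p 0) ≠ 0}
  target := {p | g (p 0) ≠ 0}
  map_source' p hp := by simpa using hp
  map_target' p hp := by simpa using hp
  left_inv' p hp := by
    have : g (p 0) ≠ 0 := hp
    ext i; fin_cases i
    · simp
    · simp; field_simp; ring
  right_inv' p hp := by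
    have : g (p 0) ≠ 0 := hp
    ext i; fin_cases i
    · simp
    · simp; field_simp
  open_source := isOpen_ne_fun (by fun_prop) continuous_const
  open_target := isOpen_ne_fun (by fun_prop) continuous_const
  continuousOn_toFun := by
    refine (contDiffOn_vec (n := 0) ?_ ?_).continuousOn
    · rw [contDiffOn_zero]; fun_prop
    · rw [contDiffOn_zero]
      exact ContinuousOn.div (by fun_prop) (by fun_prop) fun p hp => hp
  continuousOn_invFun := by
    refine (contDiffOn_vec (n := 0) ?_ ?_).continuousOn
    · rw [contDiffOn_zero]; fun_prop
    · rw [contDiffOn_zero]; fun_prop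

/-- The shear carries the curve to (τ², τ³), and the hypothesis on `Filter.map` makes τ run through
a full neighbourhood of 0, so both branches are covered. -/
theorem isLocallyOrdinaryCusp_of_shear {x y τ g h : ℝ → ℝ} {s₀ : ℝ} (hg : ContDiff ℝ ∞ g)
    (hh : ContDiff ℝ ∞ h) (hg₀ : g 0 ≠ 0) (hτ₀ : τ s₀ = 0) (hτ : Filter.map τ (𝓝 s₀) = 𝓝 0)
    (hxy : ∀ᶠ s in 𝓝 s₀,
      x s = τ s ^ 2 ∧ y s = τ s ^ 3 * g (τ s ^ 2) + (τ s ^ 2) ^ 2 * h (τ s ^ 2)) :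
    IsLocallyOrdinaryCusp (fun s => !₂[x s, y s]) s₀ := by
  have hx₀ := hxy.self_of_nhds
  rw [hτ₀] at hx₀
  have c0 := contDiff_coord 0
  have c1 := contDiff_coord 1
  refine ⟨shear g h hg.continuous hh.continuous, ?_, ?_, ?_, ?_, ?_⟩
  · refine contDiffOn_vec c0.contDiffOn (ContDiffOn.div ?_ (hg.comp c0).contDiffOn fun p hp => hp)
    exact (c1.sub ((c0.pow 2).mul (hh.comp c0))).contDiffOn
  · exact contDiffOn_vec c0.contDiffOn
      ((c1.mul (hg.comp c0)).add ((c0.pow 2).mul (hh.comp c0))).contDiffOn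
  · simp [shear, hx₀, hg₀]
  · ext i
    fin_cases i <;> simp [shear, hx₀]
  · have hg' : ∀ᶠ s in 𝓝 s₀, g (τ s ^ 2) ≠ 0 := by
      have h1 : Filter.Tendsto (fun s => g (τ s ^ 2)) (𝓝 s₀) (𝓝 (g (0 ^ 2))) :=
        ((hg.continuous.comp (continuous_pow 2)).tendsto 0).comp hτ.le
      exact h1.eventually_ne (by simpa using hg₀)
    filter_upwards [eventually_forall_Ioo (hxy.and hg'), self_mem_nhdsWithin] with ε hε hε0
    have hτε : τ '' Set.Ioo (s₀ - ε) (s₀ + ε) ∈ 𝓝 (0 : ℝ) := by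
      rw [← hτ]
      exact Filter.image_mem_map (Ioo_mem_nhds (by simpa using hε0) (by simpa using hε0))
    obtain ⟨δ, hδ, hδτ⟩ := Metric.nhds_basis_ball.mem_iff.1 hτε
    have himg : ∀ s ∈ Set.Ioo (s₀ - ε) (s₀ + ε),
        shear g h hg.continuous hh.continuous !₂[x s, y s] = !₂[τ s ^ 2, τ s ^ 3] := by
      intro s hs
      obtain ⟨⟨h1, h2⟩, h3⟩ := hε s hs
      ext i
      fin_cases i
      · simp [shear, h1]
      · simp [shear, h1, h2]; field_simp
    -- A cusp point (t², t³) in this set has |t| < δ, and such t are values of τ on the interval.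
    refine ⟨{p | p 0 < δ ^ 2}, ?_, ?_, ?_⟩
    · exact (isOpen_lt c0.continuous continuous_const).mem_nhds (by simpa using pow_pos hδ 2)
    · rintro _ ⟨s, hs, rfl⟩
      obtain ⟨⟨h1, h2⟩, h3⟩ := hε s hs
      simpa [shear, h1] using h3
    · ext p
      constructor
      · rintro ⟨⟨_, ⟨s, hs, rfl⟩, rfl⟩, hp⟩
        exact ⟨⟨τ s, (himg s hs).symm⟩, hp⟩
      · rintro ⟨⟨t, rfl⟩, hp⟩
        have ht : t ∈ Metric.ball (0 : ℝ) δ := by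
          rw [mem_ball_zero_iff, Real.norm_eq_abs]
          exact abs_lt_of_sq_lt_sq (by simpa using hp) hδ.le
        obtain ⟨s, hs, rfl⟩ := hδτ ht
        exact ⟨⟨_, ⟨s, hs, rfl⟩, himg s hs⟩, hp⟩

/-- The coordinate system `p ↦ (α ⟨v, p - p₀⟩, det (v, p - p₀))`. -/
noncomputable def frameCoordinates (p₀ v : Plane) (α : ℝ) (hα : α ≠ 0)
    (hv : v 0 ^ 2 + v 1 ^ 2 ≠ 0) : Homeomorph Plane Plane where
  toFun p := !₂[α * (v 0 * (p 0 - p₀ 0) + v 1 * (p 1 - p₀ 1)),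
    v 0 * (p 1 - p₀ 1) - v 1 * (p 0 - p₀ 0)]
  invFun p := !₂[p₀ 0 + (v 0 * (p 0 / α) - v 1 * p 1) / (v 0 ^ 2 + v 1 ^ 2),
    p₀ 1 + (v 1 * (p 0 / α) + v 0 * p 1) / (v 0 ^ 2 + v 1 ^ 2)]
  left_inv p := by
    ext i; fin_cases i <;> simp <;> field_simp <;> ring
  right_inv p := by
    ext i; fin_cases i <;> simp <;> field_simp <;> ring
  continuous_toFun := by
    refine continuousOn_univ.1 (contDiffOn_vec (n := 0) ?_ ?_).continuousOn <;>
    · rw [contDiffOn_zero]; fun_prop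
  continuous_invFun := by
    refine continuousOn_univ.1 (contDiffOn_vec (n := 0) ?_ ?_).continuousOn <;>
    · rw [contDiffOn_zero]; fun_prop

theorem hasDerivAt_coord {c : ℝ → Plane} {c' : Plane} {s : ℝ} (h : HasDerivAt c c' s) (i : Fin 2) :
    HasDerivAt (fun s => c s i) (c' i) s :=
  (EuclideanSpace.proj i : Plane →L[ℝ] ℝ).hasFDerivAt.comp_hasDerivAt s h

theorem contDiffOn_coord {c : ℝ → Plane} {U : Set ℝ} {n : WithTop ℕ∞} (h : ContDiffOn ℝ n c U)
    (i : Fin 2) : ContDiffOn ℝ n (fun s => c s i) U :=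
  (contDiffOn_euclidean.1 h) i

/-- A front is an ordinary cusp where its speed function has a simple zero. -/
theorem isLocallyOrdinaryCusp_of_front {P V : ℝ → Plane} {l : ℝ → ℝ} {U : Set ℝ} {s₀ : ℝ}
    (hU : IsOpen U) (hs₀ : s₀ ∈ U) (hl : ContDiffOn ℝ ∞ l U) (hV : ContDiffOn ℝ ∞ V U)
    (hP : ∀ s ∈ U, HasDerivAt P (l s • V s) s)
    (hdet : V s₀ 0 * deriv V s₀ 1 - V s₀ 1 * deriv V s₀ 0 ≠ 0)
    (hl₀ : l s₀ = 0) (hl₁ : deriv l s₀ ≠ 0) : IsLocallyOrdinaryCusp P s₀ := by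
  have hv : V s₀ 0 ^ 2 + V s₀ 1 ^ 2 ≠ 0 := by
    intro h
    have h0 : V s₀ 0 = 0 := by nlinarith [sq_nonneg (V s₀ 0), sq_nonneg (V s₀ 1)]
    have h1 : V s₀ 1 = 0 := by nlinarith [sq_nonneg (V s₀ 0), sq_nonneg (V s₀ 1)]
    simp [h0, h1] at hdet
  set v := V s₀ with hvdef
  set α := deriv l s₀ with hα
  have hV0 := contDiffOn_coord hV 0
  have hV1 := contDiffOn_coord hV 1
  have hsimple {f : ℝ → ℝ} (hf : ContDiffOn ℝ ∞ f U) (hf₀ : f s₀ = 0) :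
      ∃ g : ℝ → ℝ, ContDiff ℝ ∞ g ∧ g s₀ = deriv f s₀ ∧
        ∀ᶠ s in 𝓝 s₀, f s = (s - s₀) * g s := by
    obtain ⟨g, h1, h2, h3⟩ := exists_eq_pow_mul_of_hasDerivAt (k := 0) hU hs₀
      (hf.deriv_of_isOpen hU le_rfl) hf₀ fun s hs =>
      ((hf.contDiffAt (hU.mem_nhds hs)).differentiableAt (by simp)).hasDerivAt.congr_deriv
        (by simp)
    exact ⟨g, h1, by simpa using h2, by simpa using h3⟩
  obtain ⟨m, hm, hm₀, hlm⟩ := hsimple hl hl₀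
  have hdV := ((hV.contDiffAt (hU.mem_nhds hs₀)).differentiableAt (by simp)).hasDerivAt
  have hdW : HasDerivAt (fun s => v 0 * V s 1 - v 1 * V s 0)
      (v 0 * deriv V s₀ 1 - v 1 * deriv V s₀ 0) s₀ :=
    ((hasDerivAt_coord hdV 1).const_mul _).sub ((hasDerivAt_coord hdV 0).const_mul _)
  -- The component of V transverse to v = V(s₀) vanishes at s₀. This gives y' one more factor s - s₀
  -- than x', hence the orders 3 and 2.
  obtain ⟨w, hw, hw₀, hVw⟩ := hsimple (f := fun s => v 0 * V s 1 - v 1 * V s 0)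
    ((contDiffOn_const.mul hV1).sub (contDiffOn_const.mul hV0)) (by simp only [← hvdef]; ring)
  rw [hdW.deriv] at hw₀
  obtain ⟨U', hU'm, hU', hs₀'⟩ := eventually_nhds_iff.1 ((hlm.and hVw).and (hU.mem_nhds hs₀))
  have hU'U : U' ⊆ U := fun s hs => (hU'm s hs).2
  -- The factor α = l'(s₀) fixes the sign: A(s₀) = α²‖v‖²/2 is positive, whatever the sign of α.
  let x : ℝ → ℝ := fun s => α * (v 0 * (P s 0 - P s₀ 0) + v 1 * (P s 1 - P s₀ 1))
  let y : ℝ → ℝ := fun s => v 0 * (P s 1 - P s₀ 1) - v 1 * (P s 0 - P s₀ 0)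
  have hx : ∀ s ∈ U', HasDerivAt x
      ((s - s₀) ^ 1 * (α * m s * (v 0 * V s 0 + v 1 * V s 1))) s := by
    intro s hs
    have h0 := (hasDerivAt_coord (hP s (hU'U hs)) 0).sub_const (P s₀ 0)
    have h1 := (hasDerivAt_coord (hP s (hU'U hs)) 1).sub_const (P s₀ 1)
    refine (((h0.const_mul (v 0)).add (h1.const_mul (v 1))).const_mul α).congr_deriv ?_
    simp only [PiLp.smul_apply, smul_eq_mul, (hU'm s hs).1.1]
    ring
  have hy : ∀ s ∈ U', HasDerivAt y ((s - s₀) ^ 2 * (m s * w s)) s := by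
    intro s hs
    have h0 := (hasDerivAt_coord (hP s (hU'U hs)) 0).sub_const (P s₀ 0)
    have h1 := (hasDerivAt_coord (hP s (hU'U hs)) 1).sub_const (P s₀ 1)
    refine ((h1.const_mul (v 0)).sub (h0.const_mul (v 1))).congr_deriv ?_
    simp only [PiLp.smul_apply, smul_eq_mul]
    linear_combination (v 0 * V s 1 - v 1 * V s 0) * (hU'm s hs).1.1 +
      (s - s₀) * m s * (hU'm s hs).1.2
  obtain ⟨A, hA, hA₀, hxA⟩ := exists_eq_pow_mul_of_hasDerivAt hU' hs₀'
    ((contDiffOn_const.mul hm.contDiffOn).mul ((contDiffOn_const.mul (hV0.mono hU'U)).add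
      (contDiffOn_const.mul (hV1.mono hU'U)))) (by simp [x]) hx
  obtain ⟨B, hB, hB₀, hyB⟩ := exists_eq_pow_mul_of_hasDerivAt hU' hs₀'
    (hm.mul hw).contDiffOn (by simp [y]) hy
  have hA₀' : 0 < A s₀ := by
    rw [hA₀, hm₀, ← hvdef]
    have h1 : 0 < v 0 ^ 2 + v 1 ^ 2 := lt_of_le_of_ne (by positivity) hv.symm
    have h2 : 0 < α ^ 2 := by positivity
    have h3 : 0 < α ^ 2 * (v 0 ^ 2 + v 1 ^ 2) := mul_pos h2 h1
    rw [show α * α * (v 0 * v 0 + v 1 * v 1) = α ^ 2 * (v 0 ^ 2 + v 1 ^ 2) by ring]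
    positivity
  have hB₀' : B s₀ ≠ 0 := by
    rw [hB₀, hm₀, hw₀]
    exact div_ne_zero (mul_ne_zero hl₁ hdet) (by positivity)
  obtain ⟨τ, g, h, hg, hh, hg₀, hτ₀, hτ, hxy⟩ :=
    exists_normal_parameter hA hB hA₀' hB₀' hxA hyB
  have hc := isLocallyOrdinaryCusp_of_shear hg hh hg₀ hτ₀ hτ hxy
  have c0 := contDiff_coord 0
  have c1 := contDiff_coord 1
  refine hc.of_comp (frameCoordinates (P s₀) v α hl₁ hv).toOpenPartialHomeomorph ?_ ?_
    (hP s₀ hs₀).continuousAt (Set.mem_univ _) (.of_forall fun s => rfl)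
  · exact contDiffOn_vec (contDiff_const.mul ((contDiff_const.mul (c0.sub contDiff_const)).add
      (contDiff_const.mul (c1.sub contDiff_const)))).contDiffOn
      ((contDiff_const.mul (c1.sub contDiff_const)).sub
      (contDiff_const.mul (c0.sub contDiff_const))).contDiffOn
  · exact contDiffOn_vec
      (contDiff_const.add (((contDiff_const.mul (c0.div_const _)).sub
        (contDiff_const.mul c1)).div_const _)).contDiffOn
      (contDiff_const.add (((contDiff_const.mul (c0.div_const _)).add
        (contDiff_const.mul c1)).div_const _)).contDiffOn

/-! ### An ordinary cusp forces a simple zero of the speed. -/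

/-- Of the zeros of `x` between `s₀` and `s₁` there is one that is closest to `s₁`. -/
theorem exists_closest_zero {x : ℝ → ℝ} {s₀ s₁ : ℝ} (hx : ContinuousOn x (Set.uIcc s₀ s₁))
    (hx₀ : x s₀ = 0) :
    ∃ a ∈ Set.uIcc s₀ s₁, x a = 0 ∧ ∀ s ∈ Set.uIcc a s₁ \ {a}, x s ≠ 0 := by
  have hK : IsCompact (Set.uIcc s₀ s₁ ∩ x ⁻¹' {0}) :=
    isCompact_uIcc.of_isClosed_subset
      (hx.preimage_isClosed_of_isClosed isClosed_Icc isClosed_singleton) Set.inter_subset_left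
  obtain ⟨a, ha, hmin⟩ := hK.exists_isMinOn ⟨s₀, Set.left_mem_uIcc, hx₀⟩
    (f := fun s => |s - s₁|) (by fun_prop)
  refine ⟨a, ha.1, ha.2, ?_⟩
  rintro s ⟨hs, hsa⟩ h0
  have hle : |a - s₁| ≤ |s - s₁| := hmin
    ⟨Set.uIcc_subset_uIcc ha.1 Set.right_mem_uIcc hs, h0⟩
  have hsa' : s ≠ a := hsa
  rcases le_total a s₁ with h | h
  · rw [Set.uIcc_of_le h] at hs
    rw [abs_of_nonpos (by linarith), abs_of_nonpos (by linarith [hs.2])] at hle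
    exact hsa' (le_antisymm (by linarith) hs.1)
  · rw [Set.uIcc_of_ge h] at hs
    rw [abs_of_nonneg (by linarith), abs_of_nonneg (by linarith [hs.1])] at hle
    exact hsa' (le_antisymm hs.2 (by linarith))

theorem convex_uIcc_sdiff_left (a b : ℝ) : Convex ℝ (Set.uIcc a b \ {a}) := by
  rcases le_total a b with h | h
  · rw [Set.uIcc_of_le h, Set.Icc_sdiff_left]; exact convex_Ioc _ _
  · rw [Set.uIcc_of_ge h, Set.Icc_sdiff_right]; exact convex_Ico _ _

theorem mem_closure_uIcc_sdiff_left {a b : ℝ} (h : a ≠ b) : a ∈ closure (Set.uIcc a b \ {a}) := by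
  rcases lt_or_gt_of_ne h with h | h
  · rw [Set.uIcc_of_le h.le, Set.Icc_sdiff_left, closure_Ioc h.ne]; exact Set.left_mem_Icc.2 h.le
  · rw [Set.uIcc_of_ge h.le, Set.Icc_sdiff_right, closure_Ico h.ne]; exact Set.right_mem_Icc.2 h.le

/-- A differentiable function that is nonzero on a convex set but vanishes at a point of its closure
has a nonzero derivative somewhere on the set. -/
theorem exists_deriv_ne_zero_of_mem_closure {x x' : ℝ → ℝ} {S : Set ℝ} {a : ℝ} (hS : Convex ℝ S)
    (ha : a ∈ closure S) (hx : ∀ s ∈ S, HasDerivAt x (x' s) s) (hxa : ContinuousAt x a)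
    (hx0 : x a = 0) (hne : ∀ s ∈ S, x s ≠ 0) : ∃ s ∈ S, x' s ≠ 0 := by
  by_contra! hcon
  obtain ⟨s, hs⟩ : S.Nonempty := closure_nonempty_iff.1 ⟨a, ha⟩
  have hconst : ∀ r ∈ S, x r = x s := by
    intro r hr
    have := hS.norm_image_sub_le_of_norm_hasDerivWithin_le (C := 0)
      (fun t ht => (hx t ht).hasDerivWithinAt) (fun t ht => by simp [hcon t ht]) hs hr
    simpa [sub_eq_zero] using this
  have : x a ∈ closure (x '' S) := hxa.continuousWithinAt.mem_closure_image ha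
  have h2 : x '' S ⊆ {x s} := by
    rintro _ ⟨r, hr, rfl⟩
    exact hconst r hr
  have h3 := closure_mono h2 this
  rw [closure_singleton] at h3
  exact hne s hs (h3.symm.trans hx0)

/-- If the curve `(x, y)` lies on the cusp `y² = x³` then its velocity vanishes at the tip. -/
theorem velocity_eq_zero_of_cusp {x y : ℝ → ℝ} {x' y' s₀ : ℝ} (hx : HasDerivAt x x' s₀)
    (hy : HasDerivAt y y' s₀) (hx₀ : x s₀ = 0)
    (hxy : ∀ᶠ s in 𝓝 s₀, ∃ u, x s = u ^ 2 ∧ y s = u ^ 3) : x' = 0 ∧ y' = 0 := by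
  have hmin : IsLocalMin x s₀ := by
    filter_upwards [hxy] with s ⟨u, hu, _⟩
    rw [hx₀, hu]; positivity
  have hx' : x' = 0 := hmin.hasDerivAt_eq_zero hx
  refine ⟨hx', ?_⟩
  have hy₀ : y s₀ = 0 := by
    obtain ⟨u, hu, hu'⟩ := hxy.self_of_nhds
    rw [hx₀] at hu
    rw [hu', pow_eq_zero_iff (two_ne_zero) |>.1 hu.symm]
    simp
  have h1 := (hasDerivAt_iff_tendsto_slope.1 hy).pow 2
  have h2 := ((hasDerivAt_iff_tendsto_slope.1 hx).pow 2).mul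
    (hx.continuousAt.tendsto.mono_left nhdsWithin_le_nhds : Filter.Tendsto x (𝓝[≠] s₀) _)
  -- This is y² = x³ divided by (s - s₀)²; in the limit y'² = x'² · x(s₀) = 0.
  have h3 : (fun s => slope x s₀ s ^ 2 * x s) =ᶠ[𝓝[≠] s₀] fun s => slope y s₀ s ^ 2 := by
    filter_upwards [hxy.filter_mono nhdsWithin_le_nhds] with s ⟨u, hu, hu'⟩
    simp only [slope_def_field, hx₀, hy₀, hu, hu', sub_zero, div_pow]
    ring
  have h4 := tendsto_nhds_unique h1 (h2.congr' h3)
  rw [hx₀, mul_zero] at h4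
  exact pow_eq_zero_iff two_ne_zero |>.1 h4

/-- Differentiate y² = x³ and cancel l u³. Away from the tip u = y/x, so a nonzero velocity
determines the cusp parameter from its direction. -/
theorem speed_mul_eq_zero_of_cusp {x y : ℝ → ℝ} {l v₁ v₂ s : ℝ} (hx : HasDerivAt x (l * v₁) s)
    (hy : HasDerivAt y (l * v₂) s) (hxs : x s ≠ 0)
    (hxy : ∀ᶠ s in 𝓝 s, ∃ u, x s = u ^ 2 ∧ y s = u ^ 3) (hl : l ≠ 0) :
    3 * (y s / x s) * v₁ = 2 * v₂ := by
  have h1 := (hy.pow 2).sub (hx.pow 3)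
  have h2 : (y ^ 2 - x ^ 3) =ᶠ[𝓝 s] fun _ => 0 := by
    filter_upwards [hxy] with r ⟨u, hu, hu'⟩
    simp only [Pi.sub_apply, Pi.pow_apply, hu, hu']
    ring
  have h3 := (h1.congr_of_eventuallyEq h2.symm).unique (hasDerivAt_const s (0 : ℝ))
  obtain ⟨u, hu, hu'⟩ := hxy.self_of_nhds
  rw [hu] at hxs
  have hu0 : u ≠ 0 := by rintro rfl; simp at hxs
  rw [hu, hu'] at h3 ⊢
  have h4 : (l * u ^ 3) * (2 * v₂ - 3 * u * v₁) = 0 := by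
    norm_num at h3
    linear_combination h3
  have h5 := (mul_eq_zero.1 h4).resolve_left (mul_ne_zero hl (pow_ne_zero 3 hu0))
  rw [show u ^ 3 / u ^ 2 = u by field_simp]
  linarith

/-- On a convex set on which the curve `(x, y) = (u², u³)` avoids the tip but whose closure contains
a parameter of the tip, the parameter `u` is determined by the direction of the velocity. -/
theorem cusp_parameter_eq {x y l v₁ v₂ w w' : ℝ → ℝ} {U S : Set ℝ} {a : ℝ} (hU : IsOpen U)
    (hx : ∀ s ∈ U, HasDerivAt x (l s * v₁ s) s) (hy : ∀ s ∈ U, HasDerivAt y (l s * v₂ s) s)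
    (hl : ContinuousOn l U) (hv₁ : ContinuousOn v₁ U) (hv₂ : ContinuousOn v₂ U)
    (hxy : ∀ s ∈ U, ∃ u, x s = u ^ 2 ∧ y s = u ^ 3)
    (hw : ∀ s ∈ U, 3 * w s * v₁ s = 2 * v₂ s) (hv₁0 : ∀ s ∈ U, v₁ s ≠ 0)
    (hww' : ∀ s ∈ U, HasDerivAt w (w' s) s) (hw' : ContinuousOn w' U) (hw'0 : ∀ s ∈ U, w' s ≠ 0)
    (hS : Convex ℝ S) (hSU : S ⊆ U) (ha : a ∈ closure S) (haU : a ∈ U) (hxa : x a = 0)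
    (hne : ∀ s ∈ S, x s ≠ 0) : ∀ s ∈ S, y s / x s = w s := by
  have hxc : ContinuousOn x U := fun s hs => (hx s hs).continuousAt.continuousWithinAt
  have hyc : ContinuousOn y U := fun s hs => (hy s hs).continuousAt.continuousWithinAt
  have heq : ∀ s ∈ U, x s ≠ 0 → l s ≠ 0 → y s / x s = w s := by
    intro s hs hxs hls
    have h1 := speed_mul_eq_zero_of_cusp (hx s hs) (hy s hs) hxs
      (by filter_upwards [hU.mem_nhds hs] with r hr using hxy r hr) hls
    have h2 := hw s hs
    have h3 : 3 * v₁ s ≠ 0 := mul_ne_zero three_ne_zero (hv₁0 s hs)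
    apply mul_left_cancel₀ h3
    linarith
  let r : ℝ → ℝ := fun s => (l s * v₂ s * x s - y s * (l s * v₁ s)) / x s ^ 2
  have hr : ∀ s ∈ U, x s ≠ 0 → l s ≠ 0 → r s = w' s := by
    intro s hs hxs hls
    have h1 : (fun s => y s / x s) =ᶠ[𝓝 s] w := by
      filter_upwards [hU.mem_nhds hs, (hxc.continuousAt (hU.mem_nhds hs)).eventually_ne hxs,
        (hl.continuousAt (hU.mem_nhds hs)).eventually_ne hls] with t h1 h2 h3
      exact heq t h1 h2 h3
    have h2 : HasDerivAt (fun s => y s / x s) (r s) s := (hy s hs).div (hx s hs) hxs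
    exact h2.unique ((hww' s hs).congr_of_eventuallyEq h1)
  have hr0 : ∀ s, l s = 0 → r s = 0 := fun s h => by simp [r, h]
  have hrc : ContinuousOn r S :=
    (((hl.mul hv₂).mul hxc).sub (hyc.mul (hl.mul hv₁))).mono hSU |>.div ((hxc.mono hSU).pow 2)
      fun s hs => pow_ne_zero 2 (hne s hs)
  have hwS : ContinuousOn (fun s => w' s / 2) S := (hw'.mono hSU).div_const 2
  -- The derivative r of y/x equals w' where l ≠ 0 and 0 where l = 0, so r(r - w') = 0. Completing
  -- the square and using w' ≠ 0, connectedness of S forces r = w' throughout or r = 0 throughout.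
  have hor := hS.isPreconnected.eq_or_eq_neg_of_sq_eq (f := fun s => r s - w' s / 2)
    (g := fun s => w' s / 2) (hrc.sub hwS) hwS
    (fun s hs => by
      by_cases h : l s = 0
      · simp [hr0 s h]
      · simp [hr s (hSU hs) (hne s hs) h]; ring)
    (fun {s} hs => div_ne_zero (hw'0 s (hSU hs)) two_ne_zero)
  rcases hor with h | h
  · intro s hs
    refine heq s (hSU hs) (hne s hs) fun hls => hw'0 s (hSU hs) ?_
    have := h hs
    simp only [hr0 s hls] at this
    linarith
  · exfalso
    -- The case r = 0: the curve must move somewhere on S in order to reach the tip at a, and there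
    -- r = w' ≠ 0.
    obtain ⟨s, hs, hne'⟩ := exists_deriv_ne_zero_of_mem_closure hS ha
      (fun s hs => hx s (hSU hs)) (hx a haU).continuousAt hxa hne
    have hls : l s ≠ 0 := fun h => hne' (by simp [h])
    have := h hs
    simp only [hr s (hSU hs) (hne s hs) hls, Pi.neg_apply] at this
    exact hw'0 s (hSU hs) (by linarith)

/-- The speed function of a curve covering the cusp has a simple zero at the tip, provided that the
direction of the velocity turns at the tip with nonzero angular velocity. -/
theorem simple_zero_of_cusp {x y l v₁ v₂ : ℝ → ℝ} {U : Set ℝ} {s₀ : ℝ} (hU : IsOpen U)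
    (hs₀ : s₀ ∈ U) (hl : ContDiffOn ℝ ∞ l U) (hv₁ : ContDiffOn ℝ ∞ v₁ U)
    (hv₂ : ContDiffOn ℝ ∞ v₂ U) (hx : ∀ s ∈ U, HasDerivAt x (l s * v₁ s) s)
    (hy : ∀ s ∈ U, HasDerivAt y (l s * v₂ s) s) (hx₀ : x s₀ = 0)
    (hxy : ∀ᶠ s in 𝓝 s₀, ∃ u, x s = u ^ 2 ∧ y s = u ^ 3)
    (hsurj : ∀ᶠ ε in 𝓝[>] (0 : ℝ), (∃ s ∈ Set.Ioo (s₀ - ε) (s₀ + ε), 0 < y s) ∧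
      ∃ s ∈ Set.Ioo (s₀ - ε) (s₀ + ε), y s < 0)
    (hv : v₁ s₀ ≠ 0 ∨ v₂ s₀ ≠ 0) (hturn : l s₀ = 0 → v₂ s₀ = 0 → deriv v₂ s₀ ≠ 0) :
    l s₀ = 0 ∧ deriv l s₀ ≠ 0 := by
  have hl₀ : l s₀ = 0 := by
    obtain ⟨h1, h2⟩ := velocity_eq_zero_of_cusp (hx s₀ hs₀) (hy s₀ hs₀) hx₀ hxy
    rcases hv with h | h
    · exact (mul_eq_zero.1 h1).resolve_right h
    · exact (mul_eq_zero.1 h2).resolve_right h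
  refine ⟨hl₀, ?_⟩
  have hUn := hU.mem_nhds hs₀
  have hxc : ContinuousAt x s₀ := (hx s₀ hs₀).continuousAt
  have hv₁c : ContinuousAt v₁ s₀ := hv₁.continuousOn.continuousAt hUn
  have hv₂c : ContinuousAt v₂ s₀ := hv₂.continuousOn.continuousAt hUn
  have huIcc {ε s₁ : ℝ} (hs₁ : s₁ ∈ Set.Ioo (s₀ - ε) (s₀ + ε)) :
      Set.uIcc s₀ s₁ ⊆ Set.Ioo (s₀ - ε) (s₀ + ε) := by
    have hε : 0 < ε := by linarith [hs₁.1, hs₁.2]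
    exact Set.OrdConnected.uIcc_subset Set.ordConnected_Ioo
      ⟨by linarith, by linarith⟩ hs₁
  have hv₂0 : v₂ s₀ = 0 := by
    by_contra hv₂0
    -- If v₂(s₀) ≠ 0, this strict inequality holds near s₀ since x(s₀) = 0. At any moving point off
    -- the tip, 3u v₁ = 2v₂ and x = u² give equality instead.
    have hlt : ∀ᶠ s in 𝓝 s₀, 9 * x s * v₁ s ^ 2 < 4 * v₂ s ^ 2 := by
      have h1 : ContinuousAt (fun s => 9 * x s * v₁ s ^ 2) s₀ :=
        (continuousAt_const.mul hxc).mul (hv₁c.pow 2)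
      have h2 : ContinuousAt (fun s => 4 * v₂ s ^ 2) s₀ := continuousAt_const.mul (hv₂c.pow 2)
      refine h1.eventually_lt h2 ?_
      simp only [hx₀]
      have : 0 < v₂ s₀ ^ 2 := by positivity
      simpa using this
    obtain ⟨ε, ⟨⟨s₁, hs₁, hys₁⟩, -⟩, hε⟩ :=
      (hsurj.and (eventually_forall_Ioo ((hlt.and (eventually_eventually_nhds.2 hxy)).and hUn))).exists
    have hxs₁ : x s₁ ≠ 0 := by
      obtain ⟨u, hu, hu'⟩ := (hε s₁ hs₁).1.2.self_of_nhds
      rw [hu'] at hys₁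
      rw [hu]
      rintro h
      rw [pow_eq_zero_iff two_ne_zero |>.1 h] at hys₁
      simp at hys₁
    obtain ⟨a, ha, hxa, hne⟩ := exists_closest_zero (s₁ := s₁)
      (fun s hs => (hx s (hε s (huIcc hs₁ hs)).2).continuousAt.continuousWithinAt) hx₀
    have has₁ : a ≠ s₁ := by rintro rfl; exact hxs₁ hxa
    have hsub : Set.uIcc a s₁ \ {a} ⊆ Set.Ioo (s₀ - ε) (s₀ + ε) := fun s hs =>
      huIcc hs₁ (Set.uIcc_subset_uIcc ha Set.right_mem_uIcc hs.1)
    obtain ⟨s, hs, hs'⟩ := exists_deriv_ne_zero_of_mem_closure (convex_uIcc_sdiff_left a s₁)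
      (mem_closure_uIcc_sdiff_left has₁) (fun s hs => hx s (hε s (hsub hs)).2)
      (hx a (hε a (huIcc hs₁ ha)).2).continuousAt hxa hne
    obtain ⟨⟨h1, h2⟩, h3⟩ := hε s (hsub hs)
    have h4 := speed_mul_eq_zero_of_cusp (hx s h3) (hy s h3) (hne s hs) h2
      fun h => hs' (by simp [h])
    have hxs := hne s hs
    obtain ⟨u, hu, hu'⟩ := h2.self_of_nhds
    rw [hu] at hxs
    have hu0 : u ≠ 0 := by rintro rfl; simp at hxs
    rw [hu, hu', show u ^ 3 / u ^ 2 = u by field_simp] at h4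
    rw [hu] at h1
    have h5 : 9 * u ^ 2 * v₁ s ^ 2 = 4 * v₂ s ^ 2 := by
      linear_combination (3 * u * v₁ s + 2 * v₂ s) * h4
    linarith
  have hv₁0 : v₁ s₀ ≠ 0 := hv.resolve_right fun h => h hv₂0
  have hv₂' := hturn hl₀ hv₂0
  let W : Set ℝ := U ∩ v₁ ⁻¹' {0}ᶜ
  have hW : IsOpen W := hv₁.continuousOn.isOpen_inter_preimage hU isOpen_compl_singleton
  have hs₀W : s₀ ∈ W := ⟨hs₀, hv₁0⟩
  let w : ℝ → ℝ := fun s => 2 * v₂ s / (3 * v₁ s)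
  have hw : ContDiffOn ℝ ∞ w W :=
    (contDiffOn_const.mul (hv₂.mono Set.inter_subset_left)).div
      (contDiffOn_const.mul (hv₁.mono Set.inter_subset_left))
      fun s hs => mul_ne_zero three_ne_zero hs.2
  have hdw : ∀ s ∈ W, HasDerivAt w (deriv w s) s := fun s hs =>
    ((hw.contDiffAt (hW.mem_nhds hs)).differentiableAt (by simp)).hasDerivAt
  have hdwc : ContDiffOn ℝ ∞ (deriv w) W := hw.deriv_of_isOpen hW le_rfl
  have hw₀ : w s₀ = 0 := by simp [w, hv₂0]
  have hdiff {f : ℝ → ℝ} (hf : ContDiffOn ℝ ∞ f U) : HasDerivAt f (deriv f s₀) s₀ :=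
    ((hf.contDiffAt hUn).differentiableAt (by simp)).hasDerivAt
  have hmul : ∀ s ∈ W, 3 * w s * v₁ s = 2 * v₂ s := by
    intro s hs
    have : v₁ s ≠ 0 := hs.2
    simp only [w]; field_simp
  have hw'₀ : deriv w s₀ ≠ 0 := by
    intro h0
    have h1 := ((hdw s₀ hs₀W).const_mul 3).mul (hdiff hv₁)
    have h2 := (hdiff hv₂).const_mul 2
    have h3 : (fun s => 2 * v₂ s) =ᶠ[𝓝 s₀] ((fun s => 3 * w s) * v₁) := by
      filter_upwards [hW.mem_nhds hs₀W] with s hs using (hmul s hs).symm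
    have h4 := h2.unique (h1.congr_of_eventuallyEq h3)
    rw [h0, hw₀] at h4
    apply hv₂'
    linarith
  have hsign : ∀ᶠ s in 𝓝 s₀, s ≠ s₀ → 0 < w s * (s - s₀) * deriv w s₀ := by
    have h1 := (hasDerivAt_iff_tendsto_slope.1 (hdw s₀ hs₀W)).mul_const (deriv w s₀)
    have h2 : 0 < deriv w s₀ * deriv w s₀ := mul_self_pos.2 hw'₀
    have h3 := h1.eventually_const_lt h2
    rw [eventually_nhdsWithin_iff] at h3
    filter_upwards [h3] with s hs hne
    have h4 := hs hne
    have h5 : 0 < (s - s₀) ^ 2 := by have := sub_ne_zero.2 hne; positivity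
    rw [slope_def_field, hw₀, sub_zero] at h4
    have h6 := mul_pos h5 h4
    have h7 : s - s₀ ≠ 0 := sub_ne_zero.2 hne
    rwa [show (s - s₀) ^ 2 * (w s / (s - s₀) * deriv w s₀) = w s * (s - s₀) * deriv w s₀ by
      field_simp] at h6
  have hdwne : ∀ᶠ s in 𝓝 s₀, deriv w s ≠ 0 :=
    (hdwc.continuousOn.continuousAt (hW.mem_nhds hs₀W)).eventually_ne hw'₀
  obtain ⟨ε, ⟨⟨s₁, hs₁, hys₁⟩, s₂, hs₂, hys₂⟩, hε⟩ :=
    (hsurj.and (eventually_forall_Ioo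
      ((hsign.and hdwne).and (hxy.and (hW.mem_nhds hs₀W))))).exists
  have hIW : Set.Ioo (s₀ - ε) (s₀ + ε) ⊆ W := fun s hs => (hε s hs).2.2
  have hIU : Set.Ioo (s₀ - ε) (s₀ + ε) ⊆ U := hIW.trans Set.inter_subset_left
  have hside : ∀ s ∈ Set.Ioo (s₀ - ε) (s₀ + ε), y s ≠ 0 →
      ∀ r ∈ Set.uIcc s₀ s \ {s₀}, y r / x r = w r := by
    intro s hs hys
    have hxs : x s ≠ 0 := by
      obtain ⟨u, hu, hu'⟩ := (hε s hs).2.1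
      rw [hu]
      rintro h
      rw [hu', pow_eq_zero_iff two_ne_zero |>.1 h] at hys
      simp at hys
    obtain ⟨a, ha, hxa, hne⟩ := exists_closest_zero (s₁ := s)
      (fun r hr => (hx r (hIU (huIcc hs hr))).continuousAt.continuousWithinAt) hx₀
    have has : a ≠ s := by rintro rfl; exact hxs hxa
    have haI := huIcc hs ha
    have hsub : Set.uIcc a s \ {a} ⊆ Set.Ioo (s₀ - ε) (s₀ + ε) := fun r hr =>
      huIcc hs (Set.uIcc_subset_uIcc ha Set.right_mem_uIcc hr.1)
    have hpar := cusp_parameter_eq isOpen_Ioo (fun r hr => hx r (hIU hr))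
      (fun r hr => hy r (hIU hr)) (hl.continuousOn.mono hIU) (hv₁.continuousOn.mono hIU)
      (hv₂.continuousOn.mono hIU) (fun r hr => (hε r hr).2.1) (fun r hr => hmul r (hIW hr))
      (fun r hr => (hIW hr).2) (fun r hr => hdw r (hIW hr)) (hdwc.continuousOn.mono hIW)
      (fun r hr => (hε r hr).1.2) (convex_uIcc_sdiff_left a s) hsub
      (mem_closure_uIcc_sdiff_left has) haI hxa hne
    -- The identity x = w² on the side of a towards s passes to the limit a, where x vanishes. As s₀
    -- is the only zero of w in the interval, a = s₀.
    have hwa : w a = 0 := by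
      have hc : ContinuousAt (fun r => x r - w r ^ 2) a :=
        (hx a (hIU haI)).continuousAt.sub ((hdw a (hIW haI)).continuousAt.pow 2)
      have h1 := hc.continuousWithinAt.mem_closure_image (mem_closure_uIcc_sdiff_left has)
      have h2 : (fun r => x r - w r ^ 2) '' (Set.uIcc a s \ {a}) ⊆ {0} := by
        rintro _ ⟨r, hr, rfl⟩
        obtain ⟨u, hu, hu'⟩ := (hε r (hsub hr)).2.1
        have h3 := hne r hr
        rw [hu] at h3
        have hu0 : u ≠ 0 := by rintro rfl; simp at h3
        simp only [Set.mem_singleton_iff, ← hpar r hr, hu, hu']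
        field_simp
        ring
      have h3 := closure_mono h2 h1
      rw [closure_singleton, Set.mem_singleton_iff, hxa, zero_sub, neg_eq_zero] at h3
      exact pow_eq_zero_iff two_ne_zero |>.1 h3
    have has₀ : a = s₀ := by
      by_contra h
      have := (hε a haI).1.1 h
      simp [hwa] at this
    rw [has₀] at hpar
    exact hpar
  have hsq : ∀ s ∈ Set.Ioo (s₀ - ε) (s₀ + ε), y s / x s = w s → x s = w s ^ 2 := by
    intro s hs h
    obtain ⟨u, hu, hu'⟩ := (hε s hs).2.1
    rw [← h, hu, hu']
    by_cases hu0 : u = 0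
    · simp [hu0]
    · field_simp
  have hy₀ : y s₀ = 0 := by
    obtain ⟨u, hu, hu'⟩ := hxy.self_of_nhds
    rw [hx₀] at hu
    rw [hu', pow_eq_zero_iff two_ne_zero |>.1 hu.symm]
    simp
  have hs₁0 : s₁ ≠ s₀ := by rintro rfl; exact hys₁.ne' hy₀
  have hs₂0 : s₂ ≠ s₀ := by rintro rfl; exact hys₂.ne hy₀
  have hxnn : ∀ s ∈ Set.Ioo (s₀ - ε) (s₀ + ε), 0 ≤ x s := by
    intro s hs
    obtain ⟨u, hu, _⟩ := (hε s hs).2.1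
    rw [hu]; positivity
  have hw₁ : 0 ≤ w s₁ := by
    rw [← hside s₁ hs₁ hys₁.ne' s₁ ⟨Set.right_mem_uIcc, hs₁0⟩]
    exact div_nonneg hys₁.le (hxnn s₁ hs₁)
  have hw₂ : w s₂ ≤ 0 := by
    rw [← hside s₂ hs₂ hys₂.ne s₂ ⟨Set.right_mem_uIcc, hs₂0⟩]
    exact div_nonpos_of_nonpos_of_nonneg hys₂.le (hxnn s₂ hs₂)
  -- At s₁ and s₂ the value w = y/x has the sign of y, and w changes sign only at s₀; so the two
  -- branches of the cusp lie over opposite sides of s₀.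
  have hopp : (s₁ - s₀) * (s₂ - s₀) < 0 := by
    have h1 := (hε s₁ hs₁).1.1 hs₁0
    have h2 := (hε s₂ hs₂).1.1 hs₂0
    by_contra! h
    have h3 := mul_pos h1 h2
    have h4 : w s₁ * w s₂ ≤ 0 := mul_nonpos_of_nonneg_of_nonpos hw₁ hw₂
    have h5 : 0 ≤ (s₁ - s₀) * (s₂ - s₀) * deriv w s₀ ^ 2 := mul_nonneg h (sq_nonneg _)
    have h6 := mul_nonpos_of_nonpos_of_nonneg h4 h5
    linarith [show w s₁ * (s₁ - s₀) * deriv w s₀ * (w s₂ * (s₂ - s₀) * deriv w s₀) =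
      w s₁ * w s₂ * ((s₁ - s₀) * (s₂ - s₀) * deriv w s₀ ^ 2) by ring]
  have hnhd : Set.uIcc s₀ s₁ ∪ Set.uIcc s₀ s₂ ∈ 𝓝 s₀ := by
    rcases lt_or_gt_of_ne hs₁0 with h | h
    · have h' : s₀ < s₂ := by
        by_contra! h'
        exact hopp.not_ge (mul_nonneg_of_nonpos_of_nonpos (by linarith) (by linarith))
      filter_upwards [Ioo_mem_nhds h h'] with s hs
      rcases le_total s s₀ with h'' | h''
      · left; rw [Set.uIcc_of_ge h.le]; exact ⟨hs.1.le, h''⟩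
      · right; rw [Set.uIcc_of_le h'.le]; exact ⟨h'', hs.2.le⟩
    · have h' : s₂ < s₀ := by
        by_contra! h'
        exact hopp.not_ge (mul_nonneg (by linarith) (by linarith))
      filter_upwards [Ioo_mem_nhds h' h] with s hs
      rcases le_total s s₀ with h'' | h''
      · right; rw [Set.uIcc_of_ge h'.le]; exact ⟨hs.1.le, h''⟩
      · left; rw [Set.uIcc_of_le h.le]; exact ⟨h'', hs.2.le⟩
  have hxw : ∀ᶠ s in 𝓝 s₀, x s = w s ^ 2 := by
    filter_upwards [hnhd] with s hs
    by_cases hss : s = s₀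
    · rw [hss, hx₀, hw₀]; simp
    · rcases hs with hs | hs
      · exact hsq s (huIcc hs₁ hs) (hside s₁ hs₁ hys₁.ne' s ⟨hs, hss⟩)
      · exact hsq s (huIcc hs₂ hs) (hside s₂ hs₂ hys₂.ne s ⟨hs, hss⟩)
  -- The derivative of x = w². One more differentiation at s₀, where l = w = 0, leaves l'v₁ = 2w'².
  have hlv : (fun s => l s * v₁ s) =ᶠ[𝓝 s₀] fun s => 2 * w s * deriv w s := by
    filter_upwards [eventually_eventually_nhds.2 hxw, hW.mem_nhds hs₀W] with s h1 h2
    have h3 := (hx s h2.1).unique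
      (((hdw s h2).pow 2).congr_of_eventuallyEq h1)
    rw [h3]
    norm_num
  have h1 := (hdiff hl).mul (hdiff hv₁)
  have h2 := ((hdw s₀ hs₀W).const_mul 2).mul
    ((hdwc.contDiffAt (hW.mem_nhds hs₀W)).differentiableAt (by simp)).hasDerivAt
  have h3 := h1.unique (h2.congr_of_eventuallyEq hlv)
  rw [hl₀, hw₀] at h3
  intro h4
  rw [h4] at h3
  apply hw'₀
  have h5 : deriv w s₀ ^ 2 = 0 := by linarith
  exact pow_eq_zero_iff two_ne_zero |>.1 h5

theorem fderiv_injective_of_openPartialHomeomorph {Φ : OpenPartialHomeomorph Plane Plane}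
    (h : ContDiffOn ℝ ∞ Φ Φ.source) (h' : ContDiffOn ℝ ∞ Φ.symm Φ.target) {p : Plane}
    (hp : p ∈ Φ.source) : Function.Injective (fderiv ℝ Φ p) := by
  have h1 := ((h.contDiffAt (Φ.open_source.mem_nhds hp)).differentiableAt (by simp)).hasFDerivAt
  have h2 := ((h'.contDiffAt (Φ.open_target.mem_nhds (Φ.map_source hp))).differentiableAt
    (by simp)).hasFDerivAt
  have h3 : (Φ.symm ∘ Φ) =ᶠ[𝓝 p] id := by
    filter_upwards [Φ.open_source.mem_nhds hp] with q hq using Φ.left_inv hq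
  have h4 := ((h2.comp p h1).congr_of_eventuallyEq h3.symm).unique (hasFDerivAt_id p)
  refine Function.LeftInverse.injective (g := fderiv ℝ Φ.symm (Φ p)) fun v => ?_
  exact congrArg (fun T : Plane →L[ℝ] Plane => T v) h4

/-- A front that is an ordinary cusp has a speed function with a simple zero. -/
theorem simple_zero_of_isLocallyOrdinaryCusp {P V : ℝ → Plane} {l : ℝ → ℝ} {U : Set ℝ} {s₀ : ℝ}
    (hU : IsOpen U) (hs₀ : s₀ ∈ U) (hl : ContDiffOn ℝ ∞ l U) (hV : ContDiffOn ℝ ∞ V U)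
    (hP : ∀ s ∈ U, HasDerivAt P (l s • V s) s)
    (hdet : V s₀ 0 * deriv V s₀ 1 - V s₀ 1 * deriv V s₀ 0 ≠ 0)
    (h : IsLocallyOrdinaryCusp P s₀) : l s₀ = 0 ∧ deriv l s₀ ≠ 0 := by
  obtain ⟨Φ, hΦ, hΦ', hsrc, hΦ₀, hgerm⟩ := h
  have hPs : ContDiffOn ℝ ∞ P U := by
    rw [contDiffOn_infty_iff_deriv_of_isOpen hU]
    refine ⟨fun s hs => (hP s hs).differentiableAt.differentiableWithinAt, ?_⟩
    exact (hl.smul hV).congr fun s hs => (hP s hs).deriv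
  let T : Set ℝ := U ∩ P ⁻¹' Φ.source
  have hT : IsOpen T := hPs.continuousOn.isOpen_inter_preimage hU Φ.open_source
  have hs₀T : s₀ ∈ T := ⟨hs₀, hsrc⟩
  have hD : ContDiffOn ℝ ∞ (fderiv ℝ Φ) Φ.source := hΦ.fderiv_of_isOpen Φ.open_source le_rfl
  have hDP : ContDiffOn ℝ ∞ (fun s => fderiv ℝ Φ (P s)) T :=
    hD.comp (hPs.mono Set.inter_subset_left) fun s hs => hs.2
  have hv : ContDiffOn ℝ ∞ (fun s => fderiv ℝ Φ (P s) (V s)) T :=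
    hDP.clm_apply (hV.mono Set.inter_subset_left)
  have hinj := fderiv_injective_of_openPartialHomeomorph hΦ hΦ' hsrc
  have hq : ∀ s ∈ T, HasDerivAt (fun s => Φ (P s)) (l s • fderiv ℝ Φ (P s) (V s)) s := by
    intro s hs
    have h1 := ((hΦ.contDiffAt (Φ.open_source.mem_nhds hs.2)).differentiableAt
      (by simp)).hasFDerivAt
    exact (h1.comp_hasDerivAt s (hP s hs.1)).congr_deriv (map_smul _ _ _)
  have hVne : V s₀ ≠ 0 := by
    intro h0
    simp [h0] at hdet
  have hvne : fderiv ℝ Φ (P s₀) (V s₀) ≠ 0 := by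
    rw [← map_zero (fderiv ℝ Φ (P s₀))]
    exact hinj.ne hVne
  refine simple_zero_of_cusp hT hs₀T (hl.mono Set.inter_subset_left) (contDiffOn_coord hv 0)
    (contDiffOn_coord hv 1) (x := fun s => Φ (P s) 0) (y := fun s => Φ (P s) 1)
    (fun s hs => hasDerivAt_coord (hq s hs) 0) (fun s hs => hasDerivAt_coord (hq s hs) 1)
    (by simp [hΦ₀]) ?_ ?_ ?_ ?_
  · obtain ⟨ε, ⟨W, hW, -, hWeq⟩, hε⟩ := (hgerm.and self_mem_nhdsWithin).exists
    have hε' : 0 < ε := hε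
    have h1 : ∀ᶠ s in 𝓝 s₀, Φ (P s) ∈ W :=
      (hq s₀ hs₀T).continuousAt.eventually (show W ∈ 𝓝 (Φ (P s₀)) by rwa [hΦ₀])
    filter_upwards [h1, Ioo_mem_nhds (sub_lt_self s₀ hε') (lt_add_of_pos_right s₀ hε')] with s h2 h3
    have h4 : Φ (P s) ∈ ordinaryCusp ∩ W := by
      rw [← hWeq]
      exact ⟨⟨P s, ⟨s, h3, rfl⟩, rfl⟩, h2⟩
    obtain ⟨u, hu⟩ := h4.1
    exact ⟨u, by simp [← hu], by simp [← hu]⟩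
  · filter_upwards [hgerm] with ε ⟨W, hW, _, hWeq⟩
    have hcont : Continuous fun t : ℝ => (!₂[t ^ 2, t ^ 3] : Plane) :=
      continuousOn_univ.1 (contDiffOn_vec (n := 0) (contDiff_id.pow 2).contDiffOn
        (contDiff_id.pow 3).contDiffOn).continuousOn
    have h0 : (!₂[(0 : ℝ) ^ 2, 0 ^ 3] : Plane) = 0 := by
      ext i; fin_cases i <;> simp
    have h1 : ∀ᶠ t in 𝓝 (0 : ℝ), (!₂[t ^ 2, t ^ 3] : Plane) ∈ W :=
      hcont.continuousAt.eventually (show W ∈ 𝓝 (!₂[(0 : ℝ) ^ 2, 0 ^ 3] : Plane) by rwa [h0])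
    obtain ⟨δ, hδ, h2⟩ := Metric.eventually_nhds_iff_ball.1 h1
    -- Equality of germs means that every cusp point near the tip is attained; t = ±δ/2 gives both
    -- signs of the second coordinate.
    have h3 (t : ℝ) (ht : |t| < δ) : ∃ s ∈ Set.Ioo (s₀ - ε) (s₀ + ε), Φ (P s) 1 = t ^ 3 := by
      have h4 : (!₂[t ^ 2, t ^ 3] : Plane) ∈ ordinaryCusp ∩ W :=
        ⟨⟨t, rfl⟩, h2 t (by simpa using ht)⟩
      rw [← hWeq] at h4
      obtain ⟨⟨_, ⟨s, hs, rfl⟩, h5⟩, -⟩ := h4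
      exact ⟨s, hs, by simp [h5]⟩
    have hδ2 : |δ / 2| < δ := by rw [abs_of_pos (by positivity)]; linarith
    obtain ⟨s₁, h5, h6⟩ := h3 (δ / 2) hδ2
    obtain ⟨s₂, h7, h8⟩ := h3 (-(δ / 2)) (by rwa [abs_neg])
    refine ⟨⟨s₁, h5, ?_⟩, s₂, h7, ?_⟩
    · rw [h6]; positivity
    · rw [h8, Odd.neg_pow (by decide), neg_lt_zero]; positivity
  · by_contra! hcon
    apply hvne
    ext i; fin_cases i
    · exact hcon.1
    · exact hcon.2
  · intro hl₀ hv₂ hv₂'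
    -- Since P'(s₀) = 0, the differential of Φ along P is stationary at s₀, so it acts on V' as a
    -- constant matrix.
    have hD₁ : HasDerivAt (fun s => fderiv ℝ Φ (P s)) 0 s₀ := by
      have h1 := ((hD.contDiffAt (Φ.open_source.mem_nhds hsrc)).differentiableAt
        (by simp)).hasFDerivAt
      refine (h1.comp_hasDerivAt s₀ (hP s₀ hs₀)).congr_deriv ?_
      rw [hl₀, zero_smul, map_zero]
    have hV₁ := ((hV.contDiffAt (hU.mem_nhds hs₀)).differentiableAt (by simp)).hasDerivAt
    have h1 : HasDerivAt (fun s => fderiv ℝ Φ (P s) (V s))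
        (fderiv ℝ Φ (P s₀) (deriv V s₀)) s₀ := by
      simpa using hD₁.clm_apply hV₁
    rw [(hasDerivAt_coord h1 1).deriv] at hv₂'
    set D := fderiv ℝ Φ (P s₀)
    -- D V and D V' both lie on the first axis, hence are parallel; injectivity of D makes V and V'
    -- parallel, against `hdet`.
    have h2 : D (V s₀) 0 • deriv V s₀ = D (deriv V s₀) 0 • V s₀ := by
      apply hinj
      rw [map_smul, map_smul]
      ext i; fin_cases i
      · simp [mul_comm]
      · simp [hv₂, hv₂']
    have h3 : D (V s₀) 0 ≠ 0 := by
      intro h0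
      apply hvne
      ext i; fin_cases i
      · exact h0
      · exact hv₂
    have e0 : D (V s₀) 0 * deriv V s₀ 0 = D (deriv V s₀) 0 * V s₀ 0 :=
      congrArg (fun p : Plane => p 0) h2
    have e1 : D (V s₀) 0 * deriv V s₀ 1 = D (deriv V s₀) 0 * V s₀ 1 :=
      congrArg (fun p : Plane => p 1) h2
    apply hdet
    apply mul_left_cancel₀ h3
    linear_combination V s₀ 0 * e1 - V s₀ 1 * e0

theorem isLocallyOrdinaryCusp_front_iff {P V : ℝ → Plane} {l : ℝ → ℝ} {U : Set ℝ} {s₀ : ℝ}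
    (hU : IsOpen U) (hs₀ : s₀ ∈ U) (hl : ContDiffOn ℝ ∞ l U) (hV : ContDiffOn ℝ ∞ V U)
    (hP : ∀ s ∈ U, HasDerivAt P (l s • V s) s)
    (hdet : V s₀ 0 * deriv V s₀ 1 - V s₀ 1 * deriv V s₀ 0 ≠ 0) :
    IsLocallyOrdinaryCusp P s₀ ↔ l s₀ = 0 ∧ deriv l s₀ ≠ 0 :=
  ⟨simple_zero_of_isLocallyOrdinaryCusp hU hs₀ hl hV hP hdet,
    fun h => isLocallyOrdinaryCusp_of_front hU hs₀ hl hV hP hdet h.1 h.2⟩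

/-! ### Coordinates and inversion in the plane. -/

theorem norm_sq_coord (v : Plane) : ‖v‖ ^ 2 = v 0 ^ 2 + v 1 ^ 2 := by
  rw [EuclideanSpace.norm_sq_eq]; simp [Fin.sum_univ_two]

theorem inner_coord (v w : Plane) : ⟪v, w⟫ = v 0 * w 0 + v 1 * w 1 := by
  simp [PiLp.inner_apply, Fin.sum_univ_two, mul_comm]

theorem sq_add_sq_ne_zero {v : Plane} (hv : v ≠ 0) : v 0 ^ 2 + v 1 ^ 2 ≠ 0 := by
  rw [← norm_sq_coord]
  exact pow_ne_zero 2 (norm_ne_zero_iff.2 hv)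

theorem hasDerivAt_vec {f g : ℝ → ℝ} {f' g' s : ℝ} (hf : HasDerivAt f f' s)
    (hg : HasDerivAt g g' s) : HasDerivAt (fun s => (!₂[f s, g s] : Plane)) !₂[f', g'] s := by
  have e (a b : ℝ) : (!₂[a, b] : Plane) = a • !₂[1, 0] + b • !₂[0, 1] := by
    ext i; fin_cases i <;> simp
  rw [e f' g']
  exact ((hf.smul_const (!₂[1, 0] : Plane)).add
    (hg.smul_const !₂[0, 1])).congr_of_eventuallyEq (.of_forall fun _ => e _ _)

theorem Ψ_eq (v : Plane) :
    Ψ v = !₂[v 0 / (v 0 ^ 2 + v 1 ^ 2), v 1 / (v 0 ^ 2 + v 1 ^ 2)] := by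
  ext i
  fin_cases i <;>
  simp [Ψ, EuclideanGeometry.inversion, ← norm_sq_coord, div_eq_inv_mul]

/-- Inversion as a local diffeomorphism of the punctured plane. -/
noncomputable def inversionHomeomorph : OpenPartialHomeomorph Plane Plane where
  toFun := Ψ
  invFun := Ψ
  source := {0}ᶜ
  target := {0}ᶜ
  map_source' v hv := by simpa [Ψ] using hv
  map_target' v hv := by simpa [Ψ] using hv
  left_inv' v _ := EuclideanGeometry.inversion_inversion 0 one_ne_zero v
  right_inv' v _ := EuclideanGeometry.inversion_inversion 0 one_ne_zero v
  open_source := isOpen_compl_singleton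
  open_target := isOpen_compl_singleton
  continuousOn_toFun := (contDiffOn_const.inversion (n := 0) contDiffOn_const contDiffOn_id
    fun _ hv => hv).continuousOn
  continuousOn_invFun := (contDiffOn_const.inversion (n := 0) contDiffOn_const contDiffOn_id
    fun _ hv => hv).continuousOn

theorem contDiffOn_Ψ : ContDiffOn ℝ ∞ Ψ {0}ᶜ :=
  contDiffOn_const.inversion contDiffOn_const contDiffOn_id fun _ hv => hv

theorem isLocallyOrdinaryCusp_inversion_iff {c c' : ℝ → Plane} {s₀ : ℝ} (hc : ContinuousAt c s₀)
    (hc₀ : c s₀ ≠ 0) (hcc' : c' =ᶠ[𝓝 s₀] fun s => Ψ (c s)) :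
    IsLocallyOrdinaryCusp c s₀ ↔ IsLocallyOrdinaryCusp c' s₀ := by
  have hinv : ∀ v, Ψ (Ψ v) = v := EuclideanGeometry.inversion_inversion 0 one_ne_zero
  constructor
  · intro h
    refine h.of_comp inversionHomeomorph contDiffOn_Ψ contDiffOn_Ψ ?_ ?_ ?_
    · refine ContinuousAt.congr ?_ hcc'.symm
      exact (contDiffOn_Ψ.continuousOn.continuousAt
        (isOpen_compl_singleton.mem_nhds hc₀)).comp hc
    · rw [hcc'.eq_of_nhds]
      exact inversionHomeomorph.map_source hc₀
    · filter_upwards [hcc'] with s hs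
      rw [hs]
      exact (hinv _).symm
  · intro h
    exact h.of_comp inversionHomeomorph contDiffOn_Ψ contDiffOn_Ψ hc hc₀ hcc'

/-! ### Unit speed curves: primitive, inverse curve, pedal and osculating circle. -/

section UnitSpeed

variable {I : Set ℝ} {γ : ℝ → Plane}

theorem unitNormal_of_norm_deriv_eq_one {s : ℝ} (hu : ‖deriv γ s‖ = 1) :
    unitNormal γ s = !₂[-(deriv γ s 1), deriv γ s 0] := by
  simp [unitNormal, unitTangent, J, hu]

theorem inner_unitNormal_of_norm_deriv_eq_one {s : ℝ} (hu : ‖deriv γ s‖ = 1) :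
    ⟪γ s, unitNormal γ s⟫ = γ s 1 * deriv γ s 0 - γ s 0 * deriv γ s 1 := by
  rw [unitNormal_of_norm_deriv_eq_one hu, inner_coord]
  simp
  ring

theorem deriv_sq_add_sq {s : ℝ} (hu : ‖deriv γ s‖ = 1) :
    deriv γ s 0 ^ 2 + deriv γ s 1 ^ 2 = 1 := by
  rw [← norm_sq_coord, hu, one_pow]

theorem hasDerivAt_of_contDiffOn (hI : IsOpen I) (hγ : ContDiffOn ℝ ∞ γ I) {s : ℝ} (hs : s ∈ I) :
    HasDerivAt γ (deriv γ s) s :=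
  ((hγ.contDiffAt (hI.mem_nhds hs)).differentiableAt (by simp)).hasDerivAt

/-- The Frenet equations in coordinates. -/
theorem frenet (hI : IsOpen I) (hγ : ContDiffOn ℝ ∞ γ I) (hunit : ∀ s ∈ I, ‖deriv γ s‖ = 1)
    {s : ℝ} (hs : s ∈ I) :
    HasDerivAt (fun s => deriv γ s 0) (-(curvature γ s * deriv γ s 1)) s ∧
      HasDerivAt (fun s => deriv γ s 1) (curvature γ s * deriv γ s 0) s := by
  have hd := hasDerivAt_of_contDiffOn hI (hγ.deriv_of_isOpen hI le_rfl) hs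
  have h0 := hasDerivAt_coord hd 0
  have h1 := hasDerivAt_coord hd 1
  have hsq : ((fun s => deriv γ s 0) ^ 2 + (fun s => deriv γ s 1) ^ 2) =ᶠ[𝓝 s] fun _ => 1 := by
    filter_upwards [hI.mem_nhds hs] with r hr using deriv_sq_add_sq (hunit r hr)
  have h2 := (((h0.pow 2).add (h1.pow 2)).congr_of_eventuallyEq hsq.symm).unique
    (hasDerivAt_const s (1 : ℝ))
  norm_num at h2
  have h3 := deriv_sq_add_sq (hunit s hs)
  have hk : curvature γ s = deriv γ s 0 * deriv (deriv γ) s 1 -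
      deriv (deriv γ) s 0 * deriv γ s 1 := by simp [curvature, hunit s hs]
  refine ⟨h0.congr_deriv ?_, h1.congr_deriv ?_⟩
  · rw [hk]
    linear_combination deriv γ s 0 / 2 * h2 - deriv (deriv γ) s 0 * h3
  · rw [hk]
    linear_combination deriv γ s 1 / 2 * h2 - deriv (deriv γ) s 1 * h3

theorem contDiffOn_curvature (hI : IsOpen I) (hγ : ContDiffOn ℝ ∞ γ I)
    (hunit : ∀ s ∈ I, ‖deriv γ s‖ = 1) : ContDiffOn ℝ ∞ (curvature γ) I := by
  have h1 := hγ.deriv_of_isOpen hI (m := ∞) le_rfl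
  have h2 := h1.deriv_of_isOpen hI (m := ∞) le_rfl
  refine (((contDiffOn_coord h1 0).mul (contDiffOn_coord h2 1)).sub
    ((contDiffOn_coord h2 0).mul (contDiffOn_coord h1 1))).congr fun s hs => ?_
  simp [curvature, hunit s hs]

/-- The function `κ ‖γ‖² + 2 ⟨γ, n⟩` of a unit speed curve, in coordinates. It vanishes exactly
where the osculating circle passes through the origin. -/
noncomputable def osculationDefect (γ : ℝ → Plane) (s : ℝ) : ℝ :=
  curvature γ s * (γ s 0 ^ 2 + γ s 1 ^ 2) + 2 * (γ s 1 * deriv γ s 0 - γ s 0 * deriv γ s 1)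

theorem hasDerivAt_support (hI : IsOpen I) (hγ : ContDiffOn ℝ ∞ γ I)
    (hunit : ∀ s ∈ I, ‖deriv γ s‖ = 1) {s : ℝ} (hs : s ∈ I) :
    HasDerivAt (fun s => γ s 1 * deriv γ s 0 - γ s 0 * deriv γ s 1)
      (-(curvature γ s * (γ s 0 * deriv γ s 0 + γ s 1 * deriv γ s 1))) s := by
  obtain ⟨hp, hq⟩ := frenet hI hγ hunit hs
  have hd := hasDerivAt_of_contDiffOn hI hγ hs
  refine (((hasDerivAt_coord hd 1).mul hp).sub ((hasDerivAt_coord hd 0).mul hq)).congr_deriv ?_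
  ring

theorem hasDerivAt_sq_add_sq (hI : IsOpen I) (hγ : ContDiffOn ℝ ∞ γ I) {s : ℝ} (hs : s ∈ I) :
    HasDerivAt (fun s => γ s 0 ^ 2 + γ s 1 ^ 2)
      (2 * (γ s 0 * deriv γ s 0 + γ s 1 * deriv γ s 1)) s := by
  have hd := hasDerivAt_of_contDiffOn hI hγ hs
  refine (((hasDerivAt_coord hd 0).pow 2).add ((hasDerivAt_coord hd 1).pow 2)).congr_deriv ?_
  norm_num
  ring

/-- The terms 2κ⟨γ, t⟩ and -2κ⟨γ, t⟩ cancel. This is why the nondegeneracy condition is κ' ≠ 0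
throughout. -/
theorem hasDerivAt_osculationDefect (hI : IsOpen I) (hγ : ContDiffOn ℝ ∞ γ I)
    (hunit : ∀ s ∈ I, ‖deriv γ s‖ = 1) {s : ℝ} (hs : s ∈ I) :
    HasDerivAt (osculationDefect γ) (deriv (curvature γ) s * (γ s 0 ^ 2 + γ s 1 ^ 2)) s := by
  have hk := (((contDiffOn_curvature hI hγ hunit).contDiffAt (hI.mem_nhds hs)).differentiableAt
    (by simp)).hasDerivAt
  refine ((hk.mul (hasDerivAt_sq_add_sq hI hγ hs)).add
    ((hasDerivAt_support hI hγ hunit hs).const_mul 2)).congr_deriv ?_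
  ring

theorem contDiffOn_support (hI : IsOpen I) (hγ : ContDiffOn ℝ ∞ γ I) :
    ContDiffOn ℝ ∞ (fun s => γ s 1 * deriv γ s 0 - γ s 0 * deriv γ s 1) I := by
  have h1 := hγ.deriv_of_isOpen hI (m := ∞) le_rfl
  exact ((contDiffOn_coord hγ 1).mul (contDiffOn_coord h1 0)).sub
    ((contDiffOn_coord hγ 0).mul (contDiffOn_coord h1 1))

theorem contDiffOn_osculationDefect (hI : IsOpen I) (hγ : ContDiffOn ℝ ∞ γ I)
    (hunit : ∀ s ∈ I, ‖deriv γ s‖ = 1) : ContDiffOn ℝ ∞ (osculationDefect γ) I :=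
  ((contDiffOn_curvature hI hγ hunit).mul (((contDiffOn_coord hγ 0).pow 2).add
    ((contDiffOn_coord hγ 1).pow 2))).add (contDiffOn_const.mul (contDiffOn_support hI hγ))

theorem primitive_of_norm_deriv_eq_one {s : ℝ} (hu : ‖deriv γ s‖ = 1) :
    primitive γ s =
      !₂[2 * γ s 0 + (γ s 0 ^ 2 + γ s 1 ^ 2) /
          (γ s 1 * deriv γ s 0 - γ s 0 * deriv γ s 1) * deriv γ s 1,
        2 * γ s 1 - (γ s 0 ^ 2 + γ s 1 ^ 2) /
          (γ s 1 * deriv γ s 0 - γ s 0 * deriv γ s 1) * deriv γ s 0] := by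
  rw [primitive, real_inner_comm, inner_unitNormal_of_norm_deriv_eq_one hu,
    unitNormal_of_norm_deriv_eq_one hu, norm_sq_coord]
  ext i; fin_cases i <;> simp

/-- The primitive is a front whose tangent at `s` is orthogonal to `γ s`. -/
theorem hasDerivAt_primitive (hI : IsOpen I) (hγ : ContDiffOn ℝ ∞ γ I)
    (hunit : ∀ s ∈ I, ‖deriv γ s‖ = 1) {s : ℝ} (hs : s ∈ I)
    (hn : γ s 1 * deriv γ s 0 - γ s 0 * deriv γ s 1 ≠ 0) :
    HasDerivAt (primitive γ)
      ((-(osculationDefect γ s) / (γ s 1 * deriv γ s 0 - γ s 0 * deriv γ s 1) ^ 2) •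
        !₂[-(γ s 1), γ s 0]) s := by
  obtain ⟨hp, hq⟩ := frenet hI hγ hunit hs
  have hd := hasDerivAt_of_contDiffOn hI hγ hs
  have h0 := hasDerivAt_coord hd 0
  have h1 := hasDerivAt_coord hd 1
  have hf := (hasDerivAt_sq_add_sq hI hγ hs).div (hasDerivAt_support hI hγ hunit hs) hn
  have hP := hasDerivAt_vec ((h0.const_mul 2).add (hf.mul hq)) ((h1.const_mul 2).sub (hf.mul hp))
  refine (hP.congr_of_eventuallyEq ?_).congr_deriv ?_
  · filter_upwards [hI.mem_nhds hs] with r hr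
    exact primitive_of_norm_deriv_eq_one (hunit r hr)
  · have hu := deriv_sq_add_sq (hunit s hs)
    ext i
    fin_cases i
    · simp [osculationDefect]
      generalize curvature γ s = k at *
      generalize deriv γ s 0 = p at *
      generalize deriv γ s 1 = q at *
      generalize γ s 0 = a at *
      generalize γ s 1 = b at *
      obtain ⟨h, hh⟩ : ∃ h, h = b * p - a * q := ⟨_, rfl⟩
      rw [← hh] at hn ⊢
      clear hP hf hp hq h0 h1
      field_simp
      subst hh
      linear_combination (k * (a ^ 2 + b ^ 2) + 2 * (b * p - a * q)) * b * hu
    · simp [osculationDefect]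
      generalize curvature γ s = k at *
      generalize deriv γ s 0 = p at *
      generalize deriv γ s 1 = q at *
      generalize γ s 0 = a at *
      generalize γ s 1 = b at *
      obtain ⟨h, hh⟩ : ∃ h, h = b * p - a * q := ⟨_, rfl⟩
      rw [← hh] at hn ⊢
      clear hP hf hp hq h0 h1
      field_simp
      subst hh
      linear_combination -(k * (a ^ 2 + b ^ 2) + 2 * (b * p - a * q)) * a * hu

/-- The front criterion applies with V = Jγ, since det(Jγ, Jγ') = -⟨γ, n⟩ ≠ 0. Where the defect
vanishes, the derivative of the speed is -κ'‖γ‖²/⟨γ, n⟩². -/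
theorem isLocallyOrdinaryCusp_primitive_iff (hI : IsOpen I) (hγ : ContDiffOn ℝ ∞ γ I)
    (hunit : ∀ s ∈ I, ‖deriv γ s‖ = 1) (hne : ∀ s ∈ I, γ s ≠ 0) {s₀ : ℝ} (hs₀ : s₀ ∈ I)
    (hn : γ s₀ 1 * deriv γ s₀ 0 - γ s₀ 0 * deriv γ s₀ 1 ≠ 0) :
    IsLocallyOrdinaryCusp (primitive γ) s₀ ↔
      osculationDefect γ s₀ = 0 ∧ deriv (curvature γ) s₀ ≠ 0 := by
  let h : ℝ → ℝ := fun s => γ s 1 * deriv γ s 0 - γ s 0 * deriv γ s 1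
  have hh : ContDiffOn ℝ ∞ h I := contDiffOn_support hI hγ
  let U : Set ℝ := I ∩ h ⁻¹' {0}ᶜ
  have hU : IsOpen U := hh.continuousOn.isOpen_inter_preimage hI isOpen_compl_singleton
  have hUI : U ⊆ I := Set.inter_subset_left
  have hd := hasDerivAt_of_contDiffOn hI hγ hs₀
  have hV : HasDerivAt (fun s => (!₂[-(γ s 1), γ s 0] : Plane))
      !₂[-(deriv γ s₀ 1), deriv γ s₀ 0] s₀ := hasDerivAt_vec (hasDerivAt_coord hd 1).neg (hasDerivAt_coord hd 0)
  rw [isLocallyOrdinaryCusp_front_iff (U := U) (l := fun s => -(osculationDefect γ s) / h s ^ 2)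
    (V := fun s => !₂[-(γ s 1), γ s 0]) hU ⟨hs₀, hn⟩
    (((contDiffOn_osculationDefect hI hγ hunit).mono hUI).neg.div ((hh.mono hUI).pow 2)
      fun s hs => pow_ne_zero 2 hs.2)
    (contDiffOn_vec ((contDiffOn_coord hγ 1).mono hUI).neg ((contDiffOn_coord hγ 0).mono hUI))
    (fun s hs => hasDerivAt_primitive hI hγ hunit hs.1 hs.2)
    (by
      rw [hV.deriv]
      simp only [Matrix.cons_val_zero, Matrix.cons_val_one]
      intro h0
      apply hn
      linear_combination -h0)]
  have hn2 : h s₀ ^ 2 ≠ 0 := pow_ne_zero 2 hn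
  have hzero : -(osculationDefect γ s₀) / h s₀ ^ 2 = 0 ↔ osculationDefect γ s₀ = 0 := by
    rw [div_eq_zero_iff, neg_eq_zero, or_iff_left hn2]
  rw [hzero]
  refine and_congr_right fun h0 => not_congr ?_
  have hl : HasDerivAt (fun s => -(osculationDefect γ s) / h s ^ 2)
      (-(deriv (curvature γ) s₀ * (γ s₀ 0 ^ 2 + γ s₀ 1 ^ 2)) / h s₀ ^ 2) s₀ := by
    refine ((hasDerivAt_osculationDefect hI hγ hunit hs₀).neg.div
      ((hasDerivAt_support hI hγ hunit hs₀).pow 2) hn2).congr_deriv ?_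
    simp only [Pi.neg_apply, h0, Pi.pow_apply, neg_zero, zero_mul, sub_zero]
    exact mul_div_mul_right _ _ hn2 |>.symm.trans (by rw [← sq]) |>.symm
  rw [hl.deriv, div_eq_zero_iff, neg_eq_zero, or_iff_left hn2, mul_eq_zero,
    or_iff_left (sq_add_sq_ne_zero (hne s₀ hs₀))]

theorem hasDerivAt_inversion_comp (hI : IsOpen I) (hγ : ContDiffOn ℝ ∞ γ I)
    (hne : ∀ s ∈ I, γ s ≠ 0) {s : ℝ} (hs : s ∈ I) :
    HasDerivAt (Ψ ∘ γ)
      !₂[(deriv γ s 0 * (γ s 0 ^ 2 + γ s 1 ^ 2) - 2 * γ s 0 * (γ s 0 * deriv γ s 0 +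
          γ s 1 * deriv γ s 1)) / (γ s 0 ^ 2 + γ s 1 ^ 2) ^ 2,
        (deriv γ s 1 * (γ s 0 ^ 2 + γ s 1 ^ 2) - 2 * γ s 1 * (γ s 0 * deriv γ s 0 +
          γ s 1 * deriv γ s 1)) / (γ s 0 ^ 2 + γ s 1 ^ 2) ^ 2] s := by
  have hd := hasDerivAt_of_contDiffOn hI hγ hs
  have hf := hasDerivAt_sq_add_sq hI hγ hs
  have hf0 := sq_add_sq_ne_zero (hne s hs)
  refine ((hasDerivAt_vec ((hasDerivAt_coord hd 0).div hf hf0)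
    ((hasDerivAt_coord hd 1).div hf hf0)).congr_of_eventuallyEq
      (.of_forall fun r => Ψ_eq _)).congr_deriv ?_
  congr 2 <;> ring_nf

theorem norm_deriv_inversion_comp (hI : IsOpen I) (hγ : ContDiffOn ℝ ∞ γ I)
    (hunit : ∀ s ∈ I, ‖deriv γ s‖ = 1) (hne : ∀ s ∈ I, γ s ≠ 0) {s : ℝ} (hs : s ∈ I) :
    ‖deriv (Ψ ∘ γ) s‖ = 1 / (γ s 0 ^ 2 + γ s 1 ^ 2) := by
  have hf0 := sq_add_sq_ne_zero (hne s hs)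
  have hu := deriv_sq_add_sq (hunit s hs)
  rw [← sq_eq_sq₀ (norm_nonneg _) (by positivity), norm_sq_coord,
    (hasDerivAt_inversion_comp hI hγ hne hs).deriv]
  simp only [Matrix.cons_val_zero, Matrix.cons_val_one]
  field_simp
  linear_combination (γ s 0 ^ 2 + γ s 1 ^ 2) ^ 2 * hu

/-- The curvature of the inverse of a unit speed curve. -/
theorem curvature_inversion_comp (hI : IsOpen I) (hγ : ContDiffOn ℝ ∞ γ I)
    (hunit : ∀ s ∈ I, ‖deriv γ s‖ = 1) (hne : ∀ s ∈ I, γ s ≠ 0) {s : ℝ} (hs : s ∈ I) :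
    curvature (Ψ ∘ γ) s = -osculationDefect γ s := by
  have hf0 := sq_add_sq_ne_zero (hne s hs)
  have hu := deriv_sq_add_sq (hunit s hs)
  obtain ⟨hp, hq⟩ := frenet hI hγ hunit hs
  have hd := hasDerivAt_of_contDiffOn hI hγ hs
  have h0 := hasDerivAt_coord hd 0
  have h1 := hasDerivAt_coord hd 1
  have hf := hasDerivAt_sq_add_sq hI hγ hs
  have hg := (h0.mul hp).add (h1.mul hq)
  have hdd := (hasDerivAt_vec
    (((hp.mul hf).sub ((h0.const_mul 2).mul hg)).div (hf.pow 2) (pow_ne_zero 2 hf0))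
    (((hq.mul hf).sub ((h1.const_mul 2).mul hg)).div (hf.pow 2)
      (pow_ne_zero 2 hf0))).congr_of_eventuallyEq (show deriv (Ψ ∘ γ) =ᶠ[𝓝 s] _ by
        filter_upwards [hI.mem_nhds hs] with r hr
        exact (hasDerivAt_inversion_comp hI hγ hne hr).deriv)
  rw [curvature, norm_deriv_inversion_comp hI hγ hunit hne hs, hdd.deriv,
    (hasDerivAt_inversion_comp hI hγ hne hs).deriv]
  simp only [Matrix.cons_val_zero, Matrix.cons_val_one, Pi.add_apply, Pi.mul_apply, Pi.sub_apply,
    Pi.pow_apply, osculationDefect]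
  generalize curvature γ s = k at *
  generalize deriv γ s 0 = p at *
  generalize deriv γ s 1 = q at *
  generalize γ s 0 = a at *
  generalize γ s 1 = b at *
  have hk (m : ℝ) : m / (1 / (a ^ 2 + b ^ 2)) ^ 3 = m * (a ^ 2 + b ^ 2) ^ 3 := by field_simp
  rw [hk]
  clear hdd hf hg hp hq h0 h1
  field_simp
  norm_num
  linear_combination
    -(a ^ 2 + b ^ 2) ^ 3 * (k * (a ^ 2 + b ^ 2) + 2 * (b * p - a * q)) * hu

theorem isOrdinaryInflection_inversion_comp_iff (hI : IsOpen I) (hγ : ContDiffOn ℝ ∞ γ I)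
    (hunit : ∀ s ∈ I, ‖deriv γ s‖ = 1) (hne : ∀ s ∈ I, γ s ≠ 0) {s₀ : ℝ} (hs₀ : s₀ ∈ I) :
    IsOrdinaryInflection (Ψ ∘ γ) s₀ ↔
      osculationDefect γ s₀ = 0 ∧ deriv (curvature γ) s₀ ≠ 0 := by
  have h1 : curvature (Ψ ∘ γ) =ᶠ[𝓝 s₀] -osculationDefect γ := by
    filter_upwards [hI.mem_nhds hs₀] with s hs using curvature_inversion_comp hI hγ hunit hne hs
  rw [IsOrdinaryInflection, h1.deriv_eq, h1.eq_of_nhds,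
    (hasDerivAt_osculationDefect hI hγ hunit hs₀).neg.deriv, Pi.neg_apply, neg_eq_zero, neg_ne_zero]
  refine and_congr_right fun _ => ?_
  rw [mul_ne_zero_iff, and_iff_left (sq_add_sq_ne_zero (hne s₀ hs₀))]

/-- The pedal of the inverse of a curve is the inverse of its primitive. -/
theorem pedal_inversion_comp (hI : IsOpen I) (hγ : ContDiffOn ℝ ∞ γ I)
    (hunit : ∀ s ∈ I, ‖deriv γ s‖ = 1) (hne : ∀ s ∈ I, γ s ≠ 0) {s : ℝ} (hs : s ∈ I)
    (hn : γ s 1 * deriv γ s 0 - γ s 0 * deriv γ s 1 ≠ 0) :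
    pedal (Ψ ∘ γ) s = Ψ (primitive γ s) := by
  have hf0 := sq_add_sq_ne_zero (hne s hs)
  have hu := deriv_sq_add_sq (hunit s hs)
  rw [pedal, unitNormal, unitTangent, J, norm_deriv_inversion_comp hI hγ hunit hne hs,
    (hasDerivAt_inversion_comp hI hγ hne hs).deriv, Function.comp_apply, Ψ_eq, Ψ_eq,
    primitive_of_norm_deriv_eq_one (hunit s hs), inner_coord]
  simp only [PiLp.smul_apply, Matrix.cons_val_zero, Matrix.cons_val_one, smul_eq_mul]
  generalize deriv γ s 0 = p at *
  generalize deriv γ s 1 = q at *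
  generalize γ s 0 = a at *
  generalize γ s 1 = b at *
  -- The norm of the primitive is ‖γ‖²/|⟨γ, n⟩|: in the square of 2γ - k n with k⟨γ, n⟩ = ‖γ‖², the
  -- term 4‖γ‖² cancels the cross term.
  have hP : (2 * a + (a ^ 2 + b ^ 2) / (b * p - a * q) * q) ^ 2 +
      (2 * b - (a ^ 2 + b ^ 2) / (b * p - a * q) * p) ^ 2 =
      ((a ^ 2 + b ^ 2) / (b * p - a * q)) ^ 2 := by
    field_simp
    linear_combination (a ^ 2 + b ^ 2) ^ 2 * hu
  rw [hP]
  ext i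
  fin_cases i
  · simp
    field_simp
    ring
  · simp
    field_simp
    ring

theorem isLocallyOrdinaryCusp_primitive_iff_pedal (hI : IsOpen I) (hγ : ContDiffOn ℝ ∞ γ I)
    (hunit : ∀ s ∈ I, ‖deriv γ s‖ = 1) (hne : ∀ s ∈ I, γ s ≠ 0) {s₀ : ℝ} (hs₀ : s₀ ∈ I)
    (hn : γ s₀ 1 * deriv γ s₀ 0 - γ s₀ 0 * deriv γ s₀ 1 ≠ 0) :
    IsLocallyOrdinaryCusp (primitive γ) s₀ ↔ IsLocallyOrdinaryCusp (pedal (Ψ ∘ γ)) s₀ := by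
  refine isLocallyOrdinaryCusp_inversion_iff
    (hasDerivAt_primitive hI hγ hunit hs₀ hn).continuousAt ?_ ?_
  -- The primitive avoids the origin because its inner product with γ is ‖γ‖².
  · intro h0
    have hs := primitive_of_norm_deriv_eq_one (hunit s₀ hs₀)
    rw [h0] at hs
    have e0 := congrArg (fun v : Plane => v 0) hs
    have e1 := congrArg (fun v : Plane => v 1) hs
    simp only [PiLp.zero_apply, Matrix.cons_val_zero, Matrix.cons_val_one] at e0 e1
    have hk := div_mul_cancel₀ (γ s₀ 0 ^ 2 + γ s₀ 1 ^ 2) hn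
    apply sq_add_sq_ne_zero (hne s₀ hs₀)
    linear_combination (-γ s₀ 0) * e0 - γ s₀ 1 * e1 + hk
  · filter_upwards [hI.mem_nhds hs₀, ((contDiffOn_support hI hγ).continuousOn.continuousAt
      (hI.mem_nhds hs₀)).eventually_ne hn] with s hs hns
    exact pedal_inversion_comp hI hγ hunit hne hs hns

theorem osculatingCirclePassesThrough_zero_iff {s : ℝ} (hu : ‖deriv γ s‖ = 1)
    (hn : γ s 1 * deriv γ s 0 - γ s 0 * deriv γ s 1 ≠ 0) :
    OsculatingCirclePassesThrough γ s 0 ↔ osculationDefect γ s = 0 := by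
  have hu2 := deriv_sq_add_sq hu
  have hk : curvature γ s ≠ 0 → (‖0 - curvatureCenter γ s‖ ^ 2 = 1 / curvature γ s ^ 2 ↔
      osculationDefect γ s = 0) := by
    intro hk
    rw [norm_sq_coord, curvatureCenter, unitNormal_of_norm_deriv_eq_one hu, osculationDefect]
    simp only [PiLp.sub_apply, PiLp.add_apply, PiLp.smul_apply, PiLp.zero_apply, smul_eq_mul,
      Matrix.cons_val_zero, Matrix.cons_val_one]
    generalize curvature γ s = k at *
    generalize deriv γ s 0 = p at *
    generalize deriv γ s 1 = q at *
    generalize γ s 0 = a at *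
    generalize γ s 1 = b at *
    have e : (0 - (a + 1 / k * -q)) ^ 2 + (0 - (b + 1 / k * p)) ^ 2 - 1 / k ^ 2 =
        (k * (a ^ 2 + b ^ 2) + 2 * (b * p - a * q)) / k := by
      field_simp
      linear_combination hu2
    rw [← sub_eq_zero, e, div_eq_zero_iff, or_iff_left hk]
  constructor
  · rintro ⟨h1, h2⟩
    exact (hk h1).1 h2
  · intro h
    -- If κ were 0, the defect would be 2⟨γ, n⟩ ≠ 0; so the osculating circle exists automatically.
    have h1 : curvature γ s ≠ 0 := by
      intro h0
      rw [osculationDefect, h0, zero_mul, zero_add] at h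
      exact hn ((mul_eq_zero.1 h).resolve_left two_ne_zero)
    exact ⟨h1, (hk h1).2 h⟩

end UnitSpeed

end PlaneCurve

theorem theorem2p8 (I : Set ℝ) (hI : IsOpen I) (hI' : I.OrdConnected)
    (γ : ℝ → Plane) (hγ : ContDiffOn ℝ ∞ γ I)
    (hunit : ∀ s ∈ I, ‖deriv γ s‖ = 1) (hne : ∀ s ∈ I, γ s ≠ 0)
    (s₀ : ℝ) (hs₀ : s₀ ∈ I) (hn : ⟪γ s₀, unitNormal γ s₀⟫ ≠ 0) :
    List.TFAE [
      IsLocallyOrdinaryCusp (primitive γ) s₀,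
      IsLocallyOrdinaryCusp (pedal (Ψ ∘ γ)) s₀,
      curvature γ s₀ * ‖γ s₀‖ ^ 2 + 2 * ⟪γ s₀, unitNormal γ s₀⟫ = 0 ∧
        deriv (curvature γ) s₀ ≠ 0,
      ¬ IsVertex γ s₀ ∧ OsculatingCirclePassesThrough γ s₀ 0,
      IsOrdinaryInflection (Ψ ∘ γ) s₀] := by
  have hu := hunit s₀ hs₀
  have hdefect : curvature γ s₀ * ‖γ s₀‖ ^ 2 + 2 * ⟪γ s₀, unitNormal γ s₀⟫ =
      osculationDefect γ s₀ := by
    rw [inner_unitNormal_of_norm_deriv_eq_one hu, norm_sq_coord, osculationDefect]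
  rw [hdefect]
  rw [inner_unitNormal_of_norm_deriv_eq_one hu] at hn
  tfae_have 1 ↔ 2 := isLocallyOrdinaryCusp_primitive_iff_pedal hI hγ hunit hne hs₀ hn
  tfae_have 1 ↔ 3 := isLocallyOrdinaryCusp_primitive_iff hI hγ hunit hne hs₀ hn
  tfae_have 4 ↔ 3 := by
    rw [osculatingCirclePassesThrough_zero_iff hu hn, and_comm]
    rfl
  tfae_have 5 ↔ 3 := isOrdinaryInflection_inversion_comp_iff hI hγ hunit hne hs₀
  tfae_finish
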